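/- Let $r\ge 2$, $q=e^{\pi i/r}$, $q^z=e^{\pi i z/r}$ for $z\in\mathbb C$, $\{z\}=q^z-q^{-z}$, $[z]=\{z\}/\{1\}$ and $\{n\}!=\{1\}\cdots\{n\}$. Let $\overline U_q^H(\mathfrak{sl}_2)$ be the algebra generated by $E,F,K^{\pm1},H$ with relations $KE=q^2EK$, $KF=q^{-2}FK$, $HK=KH$, $[H,E]=2E$, $[H,F]=-2F$, $[E,F]=\frac{K-K^{-1}}{q-q^{-1}}$, $E^r=F^r=0$, and comultiplication $\Delta E=1\otimes E+E\otimes K$, $\Delta F=K^{-1}\otimes F+F\otimes 1$, $\Delta K=K\otimes K$, $\Delta H=1\otimes H+H\otimes 1$. A weight module is a finite-dimensional module on which $H$ is diagonalizable and $K=q^H$. Consider the weight modules * $V_\alpha$ ($\alpha\in\mathbb C$), with basis $v_0,\dots,v_{r-1}$ and $Hv_k=(\alpha+r-1-2k)v_k$, $Fv_k=v_{k+1}$, $Ev_k=[k][k-\alpha]v_{k-1}$; * $S_i$ ($0\le i\le r-2$), with basis $s_0,\dots,s_i$ and $Hs_k=(i-2k)s_k$, $Fs_k=s_{k+1}$,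 $Es_k=[k][i+1-k]s_{k-1}$; * $\mathbb C^H_{kr}$ ($k\in\mathbb Z$), one-dimensional, with $H=kr$ and $E=F=0$; * the projective cover $P_i$ of $S_i$ ($0\le i\le r-2$), of dimension $2r$, with basis $w^H_{i-2k}, w^S_{i-2k}$ ($0\le k\le i$) and $w^L_{-i-2-2k}, w^R_{i+2+2k}$ ($0\le k\le r-2-i$), where $Hw^X_m=m\,w^X_m$; $Fw^X_m=w^X_{m-2}$ for $X\in\{H,S,L\}$, except $Fw^H_{-i}=w^L_{-i-2}$, $Fw^S_{-i}=0$ and $Fw^L_{i+2-2r}=0$; $Fw^R_{i+2}=w^S_i$, $Fw^R_{i+2+2k}=-[1+i+k][k]\,w^R_{i+2k}$ for $k\ge1$; $Ew^R_m=w^R_{m+2}$, except $Ew^R_{2r-2-i}=0$; $Ew^H_i=w^R_{i+2}$, $Ew^S_i=0$, $Ew^L_{-i-2}=w^S_{-i}$; and for $k\ge 1$: $Ew^H_{i-2k}=[k][1+i-k]\,w^H_{i-2k+2}+w^S_{i-2k+2}$, $Ew^S_{i-2k}=[k][1+i-k]\,w^S_{i-2k+2}$, $Ew^L_{-i-2-2k}=-[1+i+k][k]\,w^L_{-i-2k}$.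 Let $x_{j,\ell}$ be the nilpotent endomorphism of $P_j\otimes\mathbb C^H_{\ell r}$ determined by $w^H_j\otimes v\mapsto w^S_j\otimes v$, where $v$ spans $\mathbb C^H_{\ell r}$. Let the braiding $c_{V,W}:V\otimes W\to W\otimes V$ be the action of $$R=q^{H\otimes H/2}\sum_{n=0}^{r-1}\frac{\{1\}^{2n}}{\{n\}!}\,q^{n(n-1)/2}\,E^n\otimes F^n$$ followed by the flip, let $coev_V:1\mapsto\sum_j v_j\otimes v_j^*$ and $ev'_V:v\otimes f\mapsto f(K^{1-r}v)$, and define the open Hopf link $$\Phi_{V,W}=(\mathrm{Id}_W\otimes ev'_V)(c_{V,W}\otimes\mathrm{Id}_{V^*})(c_{W,V}\otimes\mathrm{Id}_{V^*})(\mathrm{Id}_W\otimes coev_V)\in\mathrm{End}(W).$$ **Corollary.** Let $i,j\in\{0,\dots,r-2\}$, $k,\ell\in\mathbb Z$ and $\alpha\in\mathbb C$ (in particular $\alpha$ may be any typical parameter, $\alpha\in(\mathbb C\setminus\mathbb Z)\cup r\mathbb Z$). For $Z\in\{S_i\otimes\mathbb C^H_{kr},\,V_\alpha,\,P_i\otimes\mathbb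 C^H_{kr}\}$, $$\Phi_{Z,\,P_j\otimes\mathbb C^H_{\ell r}}=a_Z\,\mathrm{Id}_{P_j\otimes\mathbb C^H_{\ell r}}+b_Z\,x_{j,\ell},$$ where, with $s=(-1)^{\,i+\ell i+k(j+1-r+\ell r)}$, one has $a_{V_\alpha}=a_{P_i\otimes\mathbb C^H_{kr}}=0$ and $$a_{S_i\otimes\mathbb C^H_{kr}}=s\,\frac{\{(i+1)(j+1)\}}{\{j+1\}},\qquad b_{S_i\otimes\mathbb C^H_{kr}}=s\,\frac{i\{(i+2)(j+1)\}-(i+2)\{i(j+1)\}}{[j+1]^2\{j+1\}},$$ $$b_{V_\alpha}=(-1)^{\ell(r-1)}q^{\alpha\ell r}\,\frac{(-1)^{r-j}\,r}{[j+1]^2}\left(q^{(r-1-j)\alpha}+q^{-(r-1-j)\alpha}\right),$$ $$b_{P_i\otimes\mathbb C^H_{kr}}=s\,\frac{2r}{[j+1]^2}\left(q^{(i+1)(j+1)}+q^{-(i+1)(j+1)}\right).$$ -/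

import Mathlib

open scoped TensorProduct

namespace UnrolledSl2

noncomputable section

/-! ### Quantum numbers at `q = exp (π i / r)` -/

/-- `q ^ z` for `q = exp (π i / r)` and a complex exponent `z`. -/
def qpow (r : ℕ) (z : ℂ) : ℂ := Complex.exp (Real.pi * Complex.I * z / r)

/-- `{z} = q ^ z - q ^ (-z)`. -/
def br (r : ℕ) (z : ℂ) : ℂ := qpow r z - qpow r (-z)

/-- `[z] = {z} / {1}`. -/
def qint (r : ℕ) (z : ℂ) : ℂ := br r z / br r 1

/-- `{n}! = {1} {2} ⋯ {n}`. -/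
def brFact (r n : ℕ) : ℂ := ∏ m ∈ Finset.range n, br r ((m : ℂ) + 1)

theorem qpow_add (r : ℕ) (z w : ℂ) : qpow r (z + w) = qpow r z * qpow r w := by
  rw [qpow, qpow, qpow, ← Complex.exp_add]; congr 1; ring

theorem qpow_zero (r : ℕ) : qpow r 0 = 1 := by simp [qpow]

theorem qpow_neg_mul (r : ℕ) (z : ℂ) : qpow r (-z) * qpow r z = 1 := by
  rw [← qpow_add]; simp [qpow_zero]

theorem qpow_mul_neg (r : ℕ) (z : ℂ) : qpow r z * qpow r (-z) = 1 := by
  rw [← qpow_add]; simp [qpow_zero]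

theorem qpow_two_primitive (r : ℕ) (hr : r ≠ 0) : IsPrimitiveRoot (qpow r 2) r := by
  have h := Complex.isPrimitiveRoot_exp r hr
  have e : qpow r 2 = Complex.exp (2 * Real.pi * Complex.I / r) := by
    rw [qpow]; congr 1; ring
  rwa [e]

theorem qpow_r (r : ℕ) (hr : r ≠ 0) : qpow r r = -1 := by
  have : (r : ℂ) ≠ 0 := by exact_mod_cast hr
  rw [qpow, mul_div_assoc, div_self this, mul_one, Complex.exp_pi_mul_I]

theorem qpow_int_r (r : ℕ) (hr : r ≠ 0) (k : ℤ) : qpow r (k * r) = (-1) ^ k := by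
  have h0 : (r : ℂ) ≠ 0 := by exact_mod_cast hr
  rw [qpow, mul_div_assoc, mul_div_cancel_right₀ _ h0, mul_comm, Complex.exp_int_mul,
    Complex.exp_pi_mul_I]

theorem qint_zero (r : ℕ) : qint r 0 = 0 := by simp [qint, br]

/-! ### The algebra, by generators and relations -/

/-- The generators `E, F, K, K⁻¹, H`. -/
inductive Gen
  | E | F | K | Kinv | H

/-- The relations, for elements of an arbitrary complex algebra. -/
structure Relations (r : ℕ) {A : Type*} [Ring A] [Algebra ℂ A] (E F K Kinv H : A) : Prop where
  K_mul_Kinv : K * Kinv = 1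
  Kinv_mul_K : Kinv * K = 1
  KE : K * E = qpow r 2 • (E * K)
  KF : K * F = qpow r (-2) • (F * K)
  HK : H * K = K * H
  HE : H * E - E * H = (2 : ℂ) • E
  HF : H * F - F * H = (-2 : ℂ) • F
  EF : E * F - F * E = (qpow r 1 - qpow r (-1))⁻¹ • (K - Kinv)
  E_pow : E ^ r = 0
  F_pow : F ^ r = 0

open FreeAlgebra in
/-- The defining relations, imposed on the free algebra on the generators. -/
inductive Rel (r : ℕ) : FreeAlgebra ℂ Gen → FreeAlgebra ℂ Gen → Prop
  | K_mul_Kinv : Rel r (ι ℂ Gen.K * ι ℂ Gen.Kinv) 1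
  | Kinv_mul_K : Rel r (ι ℂ Gen.Kinv * ι ℂ Gen.K) 1
  | KE : Rel r (ι ℂ Gen.K * ι ℂ Gen.E) (qpow r 2 • (ι ℂ Gen.E * ι ℂ Gen.K))
  | KF : Rel r (ι ℂ Gen.K * ι ℂ Gen.F) (qpow r (-2) • (ι ℂ Gen.F * ι ℂ Gen.K))
  | HK : Rel r (ι ℂ Gen.H * ι ℂ Gen.K) (ι ℂ Gen.K * ι ℂ Gen.H)
  | HE : Rel r (ι ℂ Gen.H * ι ℂ Gen.E - ι ℂ Gen.E * ι ℂ Gen.H) ((2 : ℂ) • ι ℂ Gen.E)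
  | HF : Rel r (ι ℂ Gen.H * ι ℂ Gen.F - ι ℂ Gen.F * ι ℂ Gen.H) ((-2 : ℂ) • ι ℂ Gen.F)
  | EF : Rel r (ι ℂ Gen.E * ι ℂ Gen.F - ι ℂ Gen.F * ι ℂ Gen.E)
      ((qpow r 1 - qpow r (-1))⁻¹ • (ι ℂ Gen.K - ι ℂ Gen.Kinv))
  | E_pow : Rel r (ι ℂ Gen.E ^ r) 0
  | F_pow : Rel r (ι ℂ Gen.F ^ r) 0

/-- The unrolled restricted quantum group of `sl₂` at `q = exp (π i / r)`, as an algebra. -/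
abbrev UqH (r : ℕ) : Type := RingQuot (Rel r)

/-- A generator as an element of the algebra. -/
def gen (r : ℕ) (g : Gen) : UqH r := RingQuot.mkAlgHom ℂ (Rel r) (FreeAlgebra.ι ℂ g)

theorem gen_relations (r : ℕ) :
    Relations r (gen r .E) (gen r .F) (gen r .K) (gen r .Kinv) (gen r .H) := by
  constructor
  · simpa [gen] using RingQuot.mkAlgHom_rel ℂ (Rel.K_mul_Kinv (r := r))
  · simpa [gen] using RingQuot.mkAlgHom_rel ℂ (Rel.Kinv_mul_K (r := r))
  · simpa [gen] using RingQuot.mkAlgHom_rel ℂ (Rel.KE (r := r))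
  · simpa [gen] using RingQuot.mkAlgHom_rel ℂ (Rel.KF (r := r))
  · simpa [gen] using RingQuot.mkAlgHom_rel ℂ (Rel.HK (r := r))
  · simpa [gen] using RingQuot.mkAlgHom_rel ℂ (Rel.HE (r := r))
  · have h := RingQuot.mkAlgHom_rel ℂ (Rel.HF (r := r))
    simp only [map_mul, map_sub, map_smul] at h
    exact h
  · simpa [gen] using RingQuot.mkAlgHom_rel ℂ (Rel.EF (r := r))
  · simpa [gen] using RingQuot.mkAlgHom_rel ℂ (Rel.E_pow (r := r))
  · simpa [gen] using RingQuot.mkAlgHom_rel ℂ (Rel.F_pow (r := r))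

/-- The images of the generators under a map given by five elements. -/
def genMap {A : Type*} (E F K Kinv H : A) : Gen → A
  | .E => E
  | .F => F
  | .K => K
  | .Kinv => Kinv
  | .H => H

/-- Universal property: elements that satisfy the relations define an algebra homomorphism. -/
def liftU {r : ℕ} {A : Type*} [Ring A] [Algebra ℂ A] {E F K Kinv H : A}
    (h : Relations r E F K Kinv H) : UqH r →ₐ[ℂ] A :=
  RingQuot.liftAlgHom ℂ ⟨FreeAlgebra.lift ℂ (genMap E F K Kinv H), by
    intro x y hxy
    cases hxy <;>
      simp only [map_mul, map_sub, map_smul, map_pow, map_one, map_zero, FreeAlgebra.lift_ι_apply,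
        genMap]
    · exact h.K_mul_Kinv
    · exact h.Kinv_mul_K
    · exact h.KE
    · exact h.KF
    · exact h.HK
    · exact h.HE
    · exact h.HF
    · exact h.EF
    · exact h.E_pow
    · exact h.F_pow⟩

theorem liftU_gen {r : ℕ} {A : Type*} [Ring A] [Algebra ℂ A] {E F K Kinv H : A}
    (h : Relations r E F K Kinv H) (g : Gen) :
    liftU h (gen r g) = genMap E F K Kinv H g := by
  simp [liftU, gen]

theorem uqh_induction {r : ℕ} (S : Subalgebra ℂ (UqH r)) (h : ∀ g, gen r g ∈ S) (u : UqH r) :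
    u ∈ S := by
  obtain ⟨x, rfl⟩ := RingQuot.mkAlgHom_surjective ℂ (Rel r) u
  induction x using FreeAlgebra.induction with
  | grade0 c => rw [AlgHom.commutes]; exact S.algebraMap_mem c
  | grade1 g => exact h g
  | mul a b ha hb => rw [map_mul]; exact S.mul_mem ha hb
  | add a b ha hb => rw [map_add]; exact S.add_mem ha hb

/-! ### The comultiplication -/

/-- Gaussian binomial coefficients at `p`. -/
def gauss (p : ℂ) : ℕ → ℕ → ℂ
  | _, 0 => 1
  | 0, _ + 1 => 0
  | n + 1, k + 1 => gauss p n k + p ^ (k + 1) * gauss p n (k + 1)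

theorem gauss_zero (p : ℂ) (n : ℕ) : gauss p n 0 = 1 := by cases n <;> rfl

theorem gauss_of_lt (p : ℂ) (n : ℕ) : ∀ k, n < k → gauss p n k = 0 := by
  induction n with
  | zero => intro k hk; cases k with
    | zero => omega
    | succ k => rfl
  | succ n ih => intro k hk; cases k with
    | zero => omega
    | succ k => rw [gauss, ih k (by omega), ih (k + 1) (by omega)]; simp

theorem gauss_self (p : ℂ) (n : ℕ) : gauss p n n = 1 := by
  induction n with
  | zero => rfl
  | succ n ih => rw [gauss, ih, gauss_of_lt p n (n + 1) (by omega)]; simp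

theorem gauss_absorb (p : ℂ) (n : ℕ) :
    ∀ k, (1 - p ^ (k + 1)) * gauss p (n + 1) (k + 1) = (1 - p ^ (n + 1)) * gauss p n k := by
  induction n with
  | zero => intro k; cases k with
    | zero => simp [gauss]
    | succ k => simp [gauss]
  | succ n ih => intro k; cases k with
    | zero =>
      have h := ih 0
      have h3 : gauss p (n + 1 + 1) (0 + 1) = gauss p (n + 1) 0
        + p ^ (0 + 1) * gauss p (n + 1) (0 + 1) := rfl
      rw [h3, gauss_zero]
      rw [gauss_zero] at h
      linear_combination p * h
    | succ k =>
      have h1 := ih (k + 1)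
      have h2 := ih k
      have h3 : gauss p (n + 1) (k + 1) = gauss p n k + p ^ (k + 1) * gauss p n (k + 1) := rfl
      rw [show gauss p (n + 1 + 1) (k + 1 + 1) = gauss p (n + 1) (k + 1)
        + p ^ (k + 1 + 1) * gauss p (n + 1) (k + 1 + 1) from rfl]
      linear_combination p ^ (k + 2) * h1 + p * h2 - p * (1 - p ^ (n + 1)) * h3

theorem add_pow_qcomm {A : Type*} [Ring A] [Algebra ℂ A] {p : ℂ} {a b : A}
    (hab : b * a = p • (a * b)) (n : ℕ) :
    (a + b) ^ n = ∑ k ∈ Finset.range (n + 1), gauss p n k • (a ^ k * b ^ (n - k)) := by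
  have hk : ∀ k, b * a ^ k = p ^ k • (a ^ k * b) := by
    intro k
    induction k with
    | zero => simp
    | succ k ih =>
      rw [pow_succ, ← mul_assoc, ih, smul_mul_assoc, mul_assoc, hab, mul_smul_comm, smul_smul,
        pow_succ p, mul_assoc]
  induction n with
  | zero => simp [gauss]
  | succ n ih =>
    have e1 : a * ∑ k ∈ Finset.range (n + 1), gauss p n k • (a ^ k * b ^ (n - k))
        = ∑ k ∈ Finset.range (n + 1), gauss p n k • (a ^ (k + 1) * b ^ (n + 1 - (k + 1))) := by
      rw [Finset.mul_sum]
      refine Finset.sum_congr rfl fun k _ => ?_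
      rw [mul_smul_comm, ← mul_assoc, ← pow_succ', Nat.add_sub_add_right]
    have e2 : b * ∑ k ∈ Finset.range (n + 1), gauss p n k • (a ^ k * b ^ (n - k))
        = ∑ k ∈ Finset.range (n + 1 + 1), (p ^ k * gauss p n k) • (a ^ k * b ^ (n + 1 - k)) := by
      rw [Finset.sum_range_succ _ (n + 1), gauss_of_lt p n (n + 1) (by omega), mul_zero, zero_smul,
        add_zero, Finset.mul_sum]
      refine Finset.sum_congr rfl fun k hk' => ?_
      have : n + 1 - k = n - k + 1 := by
        have := Finset.mem_range.1 hk'; omega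
      rw [mul_smul_comm, ← mul_assoc, hk, smul_mul_assoc, mul_assoc, ← pow_succ', this, smul_smul,
        mul_comm]
    rw [pow_succ', ih, add_mul, e1, e2, Finset.sum_range_succ' _ (n + 1),
      Finset.sum_range_succ' _ (n + 1), ← add_assoc, ← Finset.sum_add_distrib]
    congr 1
    · refine Finset.sum_congr rfl fun k _ => ?_
      rw [← add_smul]; rfl
    · simp [gauss_zero]

theorem add_pow_eq_zero_of_qcomm {A : Type*} [Ring A] [Algebra ℂ A] {r : ℕ} {p : ℂ} {a b : A}
    (hr : r ≠ 0) (hp : IsPrimitiveRoot p r) (hab : b * a = p • (a * b)) (ha : a ^ r = 0)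
    (hb : b ^ r = 0) : (a + b) ^ r = 0 := by
  rw [add_pow_qcomm hab]
  refine Finset.sum_eq_zero fun k hk => ?_
  have hk' := Finset.mem_range.1 hk
  rcases Nat.eq_zero_or_pos k with rfl | h0
  · simp [hb]
  rcases eq_or_ne k r with rfl | h1
  · simp [ha]
  obtain ⟨m, rfl⟩ := Nat.exists_eq_succ_of_ne_zero hr
  obtain ⟨l, rfl⟩ := Nat.exists_eq_succ_of_ne_zero h0.ne'
  have h := gauss_absorb p m l
  rw [hp.pow_eq_one, sub_self, zero_mul] at h
  have h2 : (1 : ℂ) - p ^ (l + 1) ≠ 0 := by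
    intro h3
    exact hp.pow_ne_one_of_pos_of_lt (Nat.succ_ne_zero l) (by omega) (sub_eq_zero.1 h3).symm
  rw [(mul_eq_zero.1 h).resolve_left h2, zero_smul]

theorem Relations.Kinv_E {r : ℕ} {A : Type*} [Ring A] [Algebra ℂ A] {E F K Kinv H : A}
    (R : Relations r E F K Kinv H) : Kinv * E = qpow r (-2) • (E * Kinv) := by
  have h : E * K = qpow r (-2) • (K * E) := by
    rw [R.KE, smul_smul, qpow_neg_mul, one_smul]
  calc Kinv * E = Kinv * (E * K) * Kinv := by rw [mul_assoc, mul_assoc, R.K_mul_Kinv, mul_one]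
    _ = qpow r (-2) • (E * Kinv) := by
      rw [h, mul_smul_comm, ← mul_assoc, R.Kinv_mul_K, one_mul, smul_mul_assoc]

theorem Relations.Kinv_F {r : ℕ} {A : Type*} [Ring A] [Algebra ℂ A] {E F K Kinv H : A}
    (R : Relations r E F K Kinv H) : Kinv * F = qpow r 2 • (F * Kinv) := by
  have h : F * K = qpow r 2 • (K * F) := by
    rw [R.KF, smul_smul, qpow_mul_neg, one_smul]
  calc Kinv * F = Kinv * (F * K) * Kinv := by rw [mul_assoc, mul_assoc, R.K_mul_Kinv, mul_one]
    _ = qpow r 2 • (F * Kinv) := by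
      rw [h, mul_smul_comm, ← mul_assoc, R.Kinv_mul_K, one_mul, smul_mul_assoc]

theorem Relations.tensor {r : ℕ} (hr : r ≠ 0) {A : Type*} [Ring A] [Algebra ℂ A]
    {E F K Kinv H : A} (R : Relations r E F K Kinv H) :
    Relations r (A := A ⊗[ℂ] A) ((1 : A) ⊗ₜ[ℂ] E + E ⊗ₜ[ℂ] K) (Kinv ⊗ₜ[ℂ] F + F ⊗ₜ[ℂ] (1 : A))
      (K ⊗ₜ[ℂ] K) (Kinv ⊗ₜ[ℂ] Kinv) ((1 : A) ⊗ₜ[ℂ] H + H ⊗ₜ[ℂ] (1 : A)) where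
  K_mul_Kinv := by
    rw [Algebra.TensorProduct.tmul_mul_tmul, R.K_mul_Kinv]; rfl
  Kinv_mul_K := by
    rw [Algebra.TensorProduct.tmul_mul_tmul, R.Kinv_mul_K]; rfl
  KE := by
    simp only [mul_add, add_mul, Algebra.TensorProduct.tmul_mul_tmul, R.KE, mul_one, one_mul,
      TensorProduct.tmul_smul, ← TensorProduct.smul_tmul', smul_add]
  KF := by
    have h : K * Kinv = Kinv * K := by rw [R.K_mul_Kinv, R.Kinv_mul_K]
    simp only [mul_add, add_mul, Algebra.TensorProduct.tmul_mul_tmul, R.KF, mul_one, one_mul,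
      TensorProduct.tmul_smul, ← TensorProduct.smul_tmul', smul_add, h]
  HK := by
    simp only [mul_add, add_mul, Algebra.TensorProduct.tmul_mul_tmul, R.HK, mul_one, one_mul]
  HE := by
    have h1 : H * E = E * H + (2 : ℂ) • E := by rw [← R.HE]; abel
    simp only [mul_add, add_mul, Algebra.TensorProduct.tmul_mul_tmul, mul_one, one_mul, h1, R.HK,
      TensorProduct.tmul_add, TensorProduct.add_tmul, TensorProduct.tmul_smul,
      ← TensorProduct.smul_tmul', smul_add]
    abel
  HF := by
    have h1 : H * F = F * H + (-2 : ℂ) • F := by rw [← R.HF]; abel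
    have h2 : H * Kinv = Kinv * H := by
      calc H * Kinv = Kinv * (K * H) * Kinv := by
            rw [← mul_assoc, R.Kinv_mul_K, one_mul]
        _ = Kinv * H := by rw [← R.HK, mul_assoc, mul_assoc, R.K_mul_Kinv, mul_one]
    simp only [mul_add, add_mul, Algebra.TensorProduct.tmul_mul_tmul, mul_one, one_mul, h1, h2,
      TensorProduct.tmul_add, TensorProduct.add_tmul, TensorProduct.tmul_smul,
      ← TensorProduct.smul_tmul', smul_add]
    abel
  EF := by
    have h1 : E * F = F * E + (qpow r 1 - qpow r (-1))⁻¹ • (K - Kinv) := by rw [← R.EF]; abel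
    simp only [mul_add, add_mul, Algebra.TensorProduct.tmul_mul_tmul, mul_one, one_mul, h1,
      R.Kinv_E, R.KF, TensorProduct.tmul_add, TensorProduct.add_tmul, TensorProduct.tmul_smul,
      ← TensorProduct.smul_tmul', smul_sub, TensorProduct.tmul_sub, TensorProduct.sub_tmul]
    abel
  E_pow := by
    refine add_pow_eq_zero_of_qcomm hr (qpow_two_primitive r hr) ?_ ?_ ?_
    · simp only [Algebra.TensorProduct.tmul_mul_tmul, mul_one, one_mul, R.KE,
        TensorProduct.tmul_smul]
    · rw [Algebra.TensorProduct.tmul_pow, R.E_pow, TensorProduct.tmul_zero]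
    · rw [Algebra.TensorProduct.tmul_pow, R.E_pow, TensorProduct.zero_tmul]
  F_pow := by
    rw [add_comm]
    refine add_pow_eq_zero_of_qcomm hr (qpow_two_primitive r hr) ?_ ?_ ?_
    · simp only [Algebra.TensorProduct.tmul_mul_tmul, mul_one, one_mul, R.Kinv_F,
        ← TensorProduct.smul_tmul']
    · rw [Algebra.TensorProduct.tmul_pow, R.F_pow, TensorProduct.zero_tmul]
    · rw [Algebra.TensorProduct.tmul_pow, R.F_pow, TensorProduct.tmul_zero]

/-- The comultiplication:
`Δ E = 1 ⊗ E + E ⊗ K`, `Δ F = K⁻¹ ⊗ F + F ⊗ 1`, `Δ K^{±1} = K^{±1} ⊗ K^{±1}`,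
`Δ H = 1 ⊗ H + H ⊗ 1`. -/
def comul (r : ℕ) [NeZero r] : UqH r →ₐ[ℂ] UqH r ⊗[ℂ] UqH r :=
  liftU ((gen_relations r).tensor (NeZero.ne r))

/-! ### Functions of diagonalizable operators -/

/-- `φ(T)` for a diagonalizable operator `T` on a finite-dimensional space: the operator that acts
as `φ μ` on the `μ`-eigenspace of `T`, written as a polynomial in `T` that takes the value `φ μ`
at every eigenvalue `μ`. -/
def diagFun {V : Type*} [AddCommGroup V] [Module ℂ V] (T : Module.End ℂ V) (φ : ℂ → ℂ) :
    Module.End ℂ V :=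
  Polynomial.aeval T (Lagrange.interpolate (minpoly ℂ T).roots.toFinset id φ)

theorem diagFun_apply {V : Type*} [AddCommGroup V] [Module ℂ V] [FiniteDimensional ℂ V]
    (T : Module.End ℂ V) (φ : ℂ → ℂ) {μ : ℂ} {v : V} (hv : T v = μ • v) :
    diagFun T φ v = φ μ • v := by
  rcases eq_or_ne v 0 with rfl | h0
  · simp
  have hev : T.HasEigenvector μ v := ⟨Module.End.mem_eigenspace_iff.2 hv, h0⟩
  have hroot : μ ∈ (minpoly ℂ T).roots.toFinset := by
    rw [Multiset.mem_toFinset, Polynomial.mem_roots (minpoly.ne_zero (Algebra.IsIntegral.isIntegral T))]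
    exact Module.End.isRoot_of_hasEigenvalue (Module.End.hasEigenvalue_of_hasEigenvector hev)
  have h := Lagrange.eval_interpolate_at_node (v := id) φ
    (Function.injective_id.injOn (s := (↑(minpoly ℂ T).roots.toFinset : Set ℂ))) hroot
  rw [diagFun, Module.End.aeval_apply_of_hasEigenvector hev]
  rw [id] at h
  rw [h]

/-! ### Weight modules -/

/-- A weight module: a finite-dimensional module on which `H` is diagonalizable and
`K = q ^ H`. -/
structure WeightModule (r : ℕ) where
  carrier : Type
  [addCommGroup : AddCommGroup carrier]
  [module : Module ℂ carrier]
  [finiteDimensional : FiniteDimensional ℂ carrier]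
  ρ : UqH r →ₐ[ℂ] Module.End ℂ carrier
  diagonalizable : ⨆ μ : ℂ, (ρ (gen r .H)).eigenspace μ = ⊤
  K_apply : ∀ (μ : ℂ) (v : carrier), ρ (gen r .H) v = μ • v → ρ (gen r .K) v = qpow r μ • v

attribute [instance] WeightModule.addCommGroup WeightModule.module
  WeightModule.finiteDimensional

namespace WeightModule

variable {r : ℕ}

/-- A module spanned by `H`-eigenvectors on which `K` acts as `q ^ H` is a weight module. -/
def ofSpan (V : Type) [AddCommGroup V] [Module ℂ V] [FiniteDimensional ℂ V]
    (ρ : UqH r →ₐ[ℂ] Module.End ℂ V)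
    (h : Submodule.span ℂ {v | ∃ μ : ℂ, ρ (gen r .H) v = μ • v ∧ ρ (gen r .K) v = qpow r μ • v}
      = ⊤) : WeightModule r where
  carrier := V
  ρ := ρ
  diagonalizable := by
    rw [eq_top_iff, ← h, Submodule.span_le]
    rintro v ⟨μ, hv, -⟩
    exact Submodule.mem_iSup_of_mem μ (Module.End.mem_eigenspace_iff.2 hv)
  K_apply := by
    have key : ρ (gen r .K) = diagFun (ρ (gen r .H)) (qpow r) := by
      refine LinearMap.ext_on h ?_
      rintro v ⟨μ, hv, hv'⟩
      rw [hv', diagFun_apply _ _ hv]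
    intro μ v hv
    rw [key, diagFun_apply _ _ hv]

theorem span_weight (V : WeightModule r) :
    Submodule.span ℂ {v | ∃ μ : ℂ, V.ρ (gen r .H) v = μ • v} = ⊤ := by
  rw [eq_top_iff, ← V.diagonalizable, iSup_le_iff]
  intro μ v hv
  exact Submodule.subset_span ⟨μ, Module.End.mem_eigenspace_iff.1 hv⟩

variable [NeZero r]

/-- The action on a tensor product, through the comultiplication. -/
def tensorAction (V W : WeightModule r) :
    UqH r →ₐ[ℂ] Module.End ℂ (V.carrier ⊗[ℂ] W.carrier) :=
  ((Module.endTensorEndAlgHom (R := ℂ) (A := ℂ) (M := V.carrier) (N := W.carrier)).comp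
    (Algebra.TensorProduct.map V.ρ W.ρ)).comp (comul r)

theorem tensorAction_gen (V W : WeightModule r) (g : Gen) :
    tensorAction V W (gen r g) = genMap
      (TensorProduct.map 1 (W.ρ (gen r .E)) + TensorProduct.map (V.ρ (gen r .E)) (W.ρ (gen r .K)))
      (TensorProduct.map (V.ρ (gen r .Kinv)) (W.ρ (gen r .F)) + TensorProduct.map (V.ρ (gen r .F)) 1)
      (TensorProduct.map (V.ρ (gen r .K)) (W.ρ (gen r .K)))
      (TensorProduct.map (V.ρ (gen r .Kinv)) (W.ρ (gen r .Kinv)))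
      (TensorProduct.map 1 (W.ρ (gen r .H)) + TensorProduct.map (V.ρ (gen r .H)) 1) g := by
  cases g <;>
    simp [tensorAction, comul, liftU_gen, genMap, Module.endTensorEndAlgHom_apply] <;> rfl

/-- The tensor product of weight modules. -/
def tensor (V W : WeightModule r) : WeightModule r :=
  ofSpan (V.carrier ⊗[ℂ] W.carrier) (tensorAction V W) (by
    rw [eq_top_iff, ← TensorProduct.map₂_mk_top_top_eq_top, ← V.span_weight, ← W.span_weight,
      Submodule.map₂_span_span, Submodule.span_le]
    rintro _ ⟨v, ⟨μ, hv⟩, w, ⟨ν, hw⟩, rfl⟩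
    refine Submodule.subset_span ⟨μ + ν, ?_, ?_⟩
    · rw [tensorAction_gen]
      simp [genMap, hv, hw, ← TensorProduct.smul_tmul', add_smul, add_comm]
    · rw [tensorAction_gen]
      simp [genMap, V.K_apply μ v hv, W.K_apply ν w hw, ← TensorProduct.smul_tmul', smul_smul,
        qpow_add, mul_comm])

theorem tensor_E_tmul (V W : WeightModule r) (v : V.carrier) (w : W.carrier) :
    (V.tensor W).ρ (gen r .E) (v ⊗ₜ[ℂ] w : V.carrier ⊗[ℂ] W.carrier)
      = (v ⊗ₜ[ℂ] W.ρ (gen r .E) w + V.ρ (gen r .E) v ⊗ₜ[ℂ] W.ρ (gen r .K) w :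
        V.carrier ⊗[ℂ] W.carrier) :=
  LinearMap.congr_fun (tensorAction_gen V W .E) _

theorem tensor_F_tmul (V W : WeightModule r) (v : V.carrier) (w : W.carrier) :
    (V.tensor W).ρ (gen r .F) (v ⊗ₜ[ℂ] w : V.carrier ⊗[ℂ] W.carrier)
      = (V.ρ (gen r .Kinv) v ⊗ₜ[ℂ] W.ρ (gen r .F) w + V.ρ (gen r .F) v ⊗ₜ[ℂ] w :
        V.carrier ⊗[ℂ] W.carrier) :=
  LinearMap.congr_fun (tensorAction_gen V W .F) _

/-- Homomorphisms of weight modules. -/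
structure Hom (V W : WeightModule r) where
  toLin : V.carrier →ₗ[ℂ] W.carrier
  comm : ∀ u : UqH r, toLin ∘ₗ V.ρ u = W.ρ u ∘ₗ toLin

/-- A linear map that commutes with the generators is a homomorphism. -/
def Hom.ofGen {V W : WeightModule r} (f : V.carrier →ₗ[ℂ] W.carrier)
    (h : ∀ g, f ∘ₗ V.ρ (gen r g) = W.ρ (gen r g) ∘ₗ f) : Hom V W where
  toLin := f
  comm := by
    let S : Subalgebra ℂ (UqH r) :=
      { carrier := {u | f ∘ₗ V.ρ u = W.ρ u ∘ₗ f}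
        mul_mem' := by
          intro a b ha hb
          have ha' : f ∘ₗ V.ρ a = W.ρ a ∘ₗ f := ha
          have hb' : f ∘ₗ V.ρ b = W.ρ b ∘ₗ f := hb
          change f ∘ₗ V.ρ (a * b) = W.ρ (a * b) ∘ₗ f
          rw [map_mul, map_mul, Module.End.mul_eq_comp, Module.End.mul_eq_comp, ← LinearMap.comp_assoc,
            ha', LinearMap.comp_assoc, hb', LinearMap.comp_assoc]
        add_mem' := by
          intro a b ha hb
          have ha' : f ∘ₗ V.ρ a = W.ρ a ∘ₗ f := ha
          have hb' : f ∘ₗ V.ρ b = W.ρ b ∘ₗ f := hb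
          change f ∘ₗ V.ρ (a + b) = W.ρ (a + b) ∘ₗ f
          rw [map_add, map_add, LinearMap.comp_add, LinearMap.add_comp, ha', hb']
        algebraMap_mem' := by
          intro c
          change f ∘ₗ V.ρ (algebraMap ℂ _ c) = W.ρ (algebraMap ℂ _ c) ∘ₗ f
          rw [AlgHom.commutes, AlgHom.commutes]
          ext v
          simp [Module.algebraMap_end_apply] }
    exact fun u => uqh_induction S h u

/-- The endomorphism `f ⊗ Id` of `V ⊗ W`. -/
def Hom.tensorId {V : WeightModule r} (f : Hom V V) (W : WeightModule r) :
    Hom (V.tensor W) (V.tensor W) :=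
  Hom.ofGen (V := V.tensor W) (W := V.tensor W) (TensorProduct.map f.toLin LinearMap.id) (by
    intro g
    change TensorProduct.map f.toLin LinearMap.id ∘ₗ tensorAction V W (gen r g)
      = tensorAction V W (gen r g) ∘ₗ TensorProduct.map f.toLin LinearMap.id
    have hc := fun g => LinearMap.congr_fun (f.comm (gen r g))
    simp only [LinearMap.comp_apply] at hc
    rw [tensorAction_gen]
    refine TensorProduct.ext' fun v w => ?_
    cases g <;> simp [genMap, hc])

end WeightModule

/-! ### Weight modules given by the action on a basis -/

section OfBasis

variable {r : ℕ} {ι : Type}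

/-- The diagonal operator with eigenvalues `c`. -/
def diagOp (c : ι → ℂ) : Module.End ℂ (ι →₀ ℂ) :=
  Finsupp.linearCombination ℂ fun a => Finsupp.single a (c a)

/-- The operator with prescribed values on the basis vectors. -/
def opOf (f : ι → ι →₀ ℂ) : Module.End ℂ (ι →₀ ℂ) := Finsupp.linearCombination ℂ f

theorem opOf_single (f : ι → ι →₀ ℂ) (a : ι) : opOf f (Finsupp.single a 1) = f a := by
  simp [opOf]

theorem diagOp_single (c : ι → ℂ) (a : ι) :
    diagOp c (Finsupp.single a 1) = c a • Finsupp.single a 1 := by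
  simp [diagOp]

theorem op_ext {f g : Module.End ℂ (ι →₀ ℂ)}
    (h : ∀ a, f (Finsupp.single a 1) = g (Finsupp.single a 1)) : f = g :=
  Finsupp.lhom_ext' fun a => LinearMap.ext_ring (h a)

theorem supported_induction {s : Set ι} {P : (ι →₀ ℂ) → Prop} {x : ι →₀ ℂ}
    (hx : x ∈ Finsupp.supported ℂ ℂ s) (h0 : P 0) (hadd : ∀ x y, P x → P y → P (x + y))
    (hs : ∀ (c : ℂ), ∀ b ∈ s, P (c • Finsupp.single b 1)) : P x := by
  rw [← x.sum_single]
  refine Finset.sum_induction _ P hadd h0 fun b hb => ?_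
  have h := hs (x b) b (hx hb)
  rwa [Finsupp.smul_single, smul_eq_mul, mul_one] at h

theorem diagOp_of_supported {c : ι → ℂ} {μ : ℂ} {x : ι →₀ ℂ}
    (hx : x ∈ Finsupp.supported ℂ ℂ {b | c b = μ}) : diagOp c x = μ • x := by
  refine supported_induction (P := fun x => diagOp c x = μ • x) hx (by simp) ?_ ?_
  · intro x y h1 h2; rw [map_add, h1, h2, smul_add]
  · intro d b hb
    have hb' : c b = μ := hb
    rw [map_smul, diagOp_single, hb', smul_comm]

theorem opOf_pow_eq_zero {f : ι → ι →₀ ℂ} {h : ι → ℕ}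
    (hf : ∀ a, f a ∈ Finsupp.supported ℂ ℂ {b | h b < h a}) (n : ℕ) (hn : ∀ a, h a < n) :
    opOf f ^ n = 0 := by
  have key : ∀ n, ∀ x ∈ Finsupp.supported ℂ ℂ {b | h b < n}, (opOf f ^ n) x = 0 := by
    intro n
    induction n with
    | zero =>
      intro x hx
      refine supported_induction (P := fun x => (opOf f ^ 0) x = 0) hx (by simp) ?_ ?_
      · intro x y h1 h2; rw [map_add, h1, h2, add_zero]
      · intro d b hb; exact absurd hb (Nat.not_lt_zero _)
    | succ n ih =>
      intro x hx
      refine supported_induction (P := fun x => (opOf f ^ (n + 1)) x = 0) hx (by simp) ?_ ?_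
      · intro x y h1 h2; rw [map_add, h1, h2, add_zero]
      · intro d b hb
        have hb' : h b < n + 1 := hb
        rw [map_smul, pow_succ, Module.End.mul_apply, opOf_single, ih, smul_zero]
        refine Finsupp.supported_mono ?_ (hf b)
        intro c hc
        have hc' : h c < h b := hc
        exact lt_of_lt_of_le hc' (Nat.lt_succ_iff.1 hb')
  refine op_ext fun a => ?_
  rw [LinearMap.zero_apply]
  exact key n _ (Finsupp.single_mem_supported ℂ 1 (hn a))

/-- Data for a weight module with basis indexed by `ι`: the weights and the images of the basis
vectors under `E` and `F`. The two functions `hE`, `hF` witness the nilpotency of `E` and `F`. -/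
structure BasisData (r : ℕ) (ι : Type) where
  wt : ι → ℂ
  E : ι → ι →₀ ℂ
  F : ι → ι →₀ ℂ
  hE : ι → ℕ
  hF : ι → ℕ
  hE_lt : ∀ a, hE a < r
  hF_lt : ∀ a, hF a < r
  E_mem : ∀ a, E a ∈ Finsupp.supported ℂ ℂ {b | wt b = wt a + 2 ∧ hE b < hE a}
  F_mem : ∀ a, F a ∈ Finsupp.supported ℂ ℂ {b | wt b = wt a - 2 ∧ hF b < hF a}
  EF : ∀ a, opOf E (F a) - opOf F (E a) = qint r (wt a) • Finsupp.single a 1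

theorem BasisData.relations (D : BasisData r ι) :
    Relations r (opOf D.E) (opOf D.F) (diagOp fun a => qpow r (D.wt a))
      (diagOp fun a => qpow r (-D.wt a)) (diagOp D.wt) := by
  have sE : ∀ a (c : ℂ → ℂ), diagOp (fun b => c (D.wt b)) (D.E a) = c (D.wt a + 2) • D.E a := by
    intro a c
    refine diagOp_of_supported (Finsupp.supported_mono ?_ (D.E_mem a))
    rintro b ⟨hb, -⟩
    change c (D.wt b) = _
    rw [hb]
  have sF : ∀ a (c : ℂ → ℂ), diagOp (fun b => c (D.wt b)) (D.F a) = c (D.wt a - 2) • D.F a := by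
    intro a c
    refine diagOp_of_supported (Finsupp.supported_mono ?_ (D.F_mem a))
    rintro b ⟨hb, -⟩
    change c (D.wt b) = _
    rw [hb]
  constructor
  · refine op_ext fun a => ?_
    simp only [Module.End.mul_apply, diagOp_single, map_smul, smul_smul, Module.End.one_apply]
    rw [qpow_neg_mul, one_smul]
  · refine op_ext fun a => ?_
    simp only [Module.End.mul_apply, diagOp_single, map_smul, smul_smul, Module.End.one_apply]
    rw [qpow_mul_neg, one_smul]
  · refine op_ext fun a => ?_
    simp only [Module.End.mul_apply, diagOp_single, map_smul, smul_smul, LinearMap.smul_apply,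
      opOf_single]
    rw [sE a (qpow r), qpow_add, mul_comm]
  · refine op_ext fun a => ?_
    simp only [Module.End.mul_apply, diagOp_single, map_smul, smul_smul, LinearMap.smul_apply,
      opOf_single]
    rw [sF a (qpow r), sub_eq_add_neg, qpow_add, mul_comm]
  · refine op_ext fun a => ?_
    simp only [Module.End.mul_apply, diagOp_single, map_smul, smul_smul]
    rw [mul_comm]
  · refine op_ext fun a => ?_
    simp only [Module.End.mul_apply, diagOp_single, map_smul, LinearMap.smul_apply,
      opOf_single, LinearMap.sub_apply]
    rw [sE a (fun z => z), ← sub_smul]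
    congr 1; ring
  · refine op_ext fun a => ?_
    simp only [Module.End.mul_apply, diagOp_single, map_smul, LinearMap.smul_apply,
      opOf_single, LinearMap.sub_apply]
    rw [sF a (fun z => z), ← sub_smul]
    congr 1; ring
  · refine op_ext fun a => ?_
    simp only [Module.End.mul_apply, diagOp_single, LinearMap.smul_apply,
      opOf_single, LinearMap.sub_apply]
    rw [D.EF, ← sub_smul, smul_smul, qint, br, br, div_eq_inv_mul]
  · refine opOf_pow_eq_zero (h := D.hE) (fun a => Finsupp.supported_mono ?_ (D.E_mem a)) r D.hE_lt
    exact fun b hb => hb.2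
  · refine opOf_pow_eq_zero (h := D.hF) (fun a => Finsupp.supported_mono ?_ (D.F_mem a)) r D.hF_lt
    exact fun b hb => hb.2

/-- The weight module defined by such data: `H` and `K` act diagonally by `wt` and `q ^ wt`. -/
def BasisData.toWeightModule [Finite ι] (D : BasisData r ι) : WeightModule r :=
  WeightModule.ofSpan (ι →₀ ℂ) (liftU D.relations) (by
    rw [eq_top_iff]
    intro x _
    refine supported_induction (s := Set.univ) (x := x) (by simp) (Submodule.zero_mem _)
      (fun x y => Submodule.add_mem _) fun c b _ => Submodule.smul_mem _ _ (Submodule.subset_span ?_)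
    refine ⟨D.wt b, ?_, ?_⟩
    · rw [liftU_gen]; exact diagOp_single _ _
    · rw [liftU_gen]; exact diagOp_single _ _)

end OfBasis

/-! ### Simple and typical modules -/

/-- The basis vector with index `k`, and zero if there is none. -/
def vec (n k : ℕ) : Fin n →₀ ℂ := if h : k < n then Finsupp.single ⟨k, h⟩ 1 else 0

theorem vec_mem {n k : ℕ} {s : Set (Fin n)} (h : ∀ hk : k < n, (⟨k, hk⟩ : Fin n) ∈ s) :
    vec n k ∈ Finsupp.supported ℂ ℂ s := by
  unfold vec
  split_ifs with hk
  · exact Finsupp.single_mem_supported ℂ 1 (h hk)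
  · exact Submodule.zero_mem _

theorem opOf_vec {n : ℕ} (f : Fin n → Fin n →₀ ℂ) (k : ℕ) :
    opOf f (vec n k) = if h : k < n then f ⟨k, h⟩ else 0 := by
  unfold vec
  split_ifs with hk
  · exact opOf_single _ _
  · exact map_zero _

/-- The `n`-dimensional module with basis `v_0, …, v_{n-1}` and action
`H v_k = (lam - 2k) v_k`, `F v_k = v_{k+1}`, `E v_k = c_k v_{k-1}` (with `v_n = 0`, `c_0 = 0`). -/
def stringModule (r n : ℕ) (lam : ℂ) (c : ℕ → ℂ) (hn : n ≤ r) (h0 : c 0 = 0) (hcn : c n = 0)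
    (hc : ∀ k : ℕ, k < n → c (k + 1) - c k = qint r (lam - 2 * k)) : WeightModule r :=
  BasisData.toWeightModule (ι := Fin n)
    { wt := fun k => lam - 2 * (k : ℕ)
      E := fun k => c k • vec n (k - 1)
      F := fun k => vec n (k + 1)
      hE := fun k => k
      hF := fun k => n - 1 - k
      hE_lt := fun k => lt_of_lt_of_le k.2 hn
      hF_lt := fun k => by have := k.2; omega
      E_mem := by
        rintro ⟨k, hk⟩
        rcases k with _ | k
        · simp [h0]
        · refine Submodule.smul_mem _ _ (vec_mem fun h => ⟨?_, ?_⟩)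
          · simp; ring
          · simp
      F_mem := by
        rintro ⟨k, hk⟩
        refine vec_mem fun h => ⟨?_, ?_⟩
        · simp; ring
        · change n - 1 - (k + 1) < n - 1 - k
          have h' : k + 1 < n := h
          clear h
          omega
      EF := by
        rintro ⟨k, hk⟩
        have hs : (Finsupp.single (⟨k, hk⟩ : Fin n) (1 : ℂ)) = vec n k := by simp [vec, hk]
        have e1 : opOf (fun k : Fin n => c k • vec n (k - 1)) (vec n (k + 1))
            = c (k + 1) • vec n k := by
          rw [opOf_vec]
          split_ifs with h
          · rfl
          · have : k + 1 = n := by omega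
            rw [this, hcn, zero_smul]
        have e2 : opOf (fun k : Fin n => vec n (k + 1)) (c k • vec n (k - 1))
            = c k • vec n k := by
          rcases k with _ | k
          · rw [h0, zero_smul]; exact map_zero _
          · rw [map_smul, opOf_vec]
            simp [show k < n by omega]
        change opOf (fun k : Fin n => c k • vec n (k - 1)) (vec n (k + 1))
          - opOf (fun k : Fin n => vec n (k + 1)) (c k • vec n (k - 1)) = _
        rw [hs, e1, e2, ← sub_smul, hc k hk] }

theorem qint_mul_sub (r : ℕ) (x y : ℂ) :
    qint r (x + 1) * qint r (y + 1) - qint r x * qint r y = qint r (x + y + 1) := by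
  have e1 : qpow r (x + 1) = qpow r x * qpow r 1 := qpow_add _ _ _
  have e2 : qpow r (-(x + 1)) = qpow r (-x) * qpow r (-1) := by rw [← qpow_add]; congr 1; ring
  have e3 : qpow r (y + 1) = qpow r y * qpow r 1 := qpow_add _ _ _
  have e4 : qpow r (-(y + 1)) = qpow r (-y) * qpow r (-1) := by rw [← qpow_add]; congr 1; ring
  have e5 : qpow r (x + y + 1) = qpow r x * qpow r y * qpow r 1 := by rw [qpow_add, qpow_add]
  have e6 : qpow r (-(x + y + 1)) = qpow r (-x) * qpow r (-y) * qpow r (-1) := by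
    rw [← qpow_add, ← qpow_add]; congr 1; ring
  simp only [qint, br, e1, e2, e3, e4, e5, e6]
  have h := qpow_mul_neg r 1
  rcases eq_or_ne (qpow r 1 - qpow r (-1)) 0 with h0 | h0
  · simp [h0]
  · field_simp
    linear_combination (qpow r x * qpow r y + qpow r (-x) * qpow r (-y)
      - qpow r x * qpow r (-y) - qpow r (-x) * qpow r y) * h

theorem qint_neg (r : ℕ) (z : ℂ) : qint r (-z) = -qint r z := by
  simp only [qint, br, neg_neg]; ring

theorem qint_add_r (r : ℕ) [NeZero r] (z : ℂ) : qint r (z + r) = -qint r z := by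
  have e1 : qpow r (z + r) = -qpow r z := by rw [qpow_add, qpow_r r (NeZero.ne r)]; ring
  have e2 : qpow r (-(z + r)) = -qpow r (-z) := by
    have h := qpow_mul_neg r r
    rw [qpow_r r (NeZero.ne r)] at h
    rw [neg_add, qpow_add]
    linear_combination -qpow r (-z) * h
  simp only [qint, br, e1, e2]; ring

theorem qint_r (r : ℕ) [NeZero r] : qint r r = 0 := by
  have h := qint_add_r r 0
  rwa [zero_add, qint_zero, neg_zero] at h

/-- `V_α`, of dimension `r`, with basis `v_0, …, v_{r-1}` and
`H v_k = (α + r - 1 - 2k) v_k`, `F v_k = v_{k+1}`, `E v_k = [k] [k - α] v_{k-1}`. -/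
def V (r : ℕ) [NeZero r] (α : ℂ) : WeightModule r :=
  stringModule r r (α + r - 1) (fun k => qint r k * qint r (k - α)) le_rfl (by simp [qint_zero])
    (by simp [qint_r]) (by
      intro k _
      have h := qint_mul_sub r k (k - α)
      have h2 := qint_add_r r (-(k + (k - α) + 1))
      rw [qint_neg, neg_neg] at h2
      push_cast
      rw [show (k : ℂ) + 1 - α = k - α + 1 by ring, h, ← h2]
      congr 1; ring)

/-- `S_n` (`n ≤ r - 1`), of dimension `n + 1`, with basis `s_0, …, s_n` and
`H s_k = (n - 2k) s_k`, `F s_k = s_{k+1}`, `E s_k = [k] [n + 1 - k] s_{k-1}`. -/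
def S (r n : ℕ) (hn : n < r) : WeightModule r :=
  stringModule r (n + 1) n (fun k => qint r k * qint r (n + 1 - k)) hn (by simp [qint_zero])
    (by simp [qint_zero]) (by
      intro k _
      have h := qint_mul_sub r k (k - n - 1)
      rw [show (n : ℂ) + 1 - (k + 1 : ℕ) = -(k - n - 1 + 1) by push_cast; ring,
        show (n : ℂ) + 1 - k = -(k - n - 1) by ring, qint_neg, qint_neg,
        show (n : ℂ) - 2 * k = -(k + (k - n - 1) + 1) by ring, qint_neg, ← h]
      push_cast
      ring)

theorem qint_int_r (r : ℕ) [NeZero r] (k : ℤ) : qint r (k * r) = 0 := by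
  have h := qpow_int_r r (NeZero.ne r) k
  have h' := qpow_int_r r (NeZero.ne r) (-k)
  rw [qint, br, h, ← neg_mul, ← Int.cast_neg, h', zpow_neg]
  rcases Int.even_or_odd k with hk | hk
  · simp [hk.neg_one_zpow]
  · rw [hk.neg_one_zpow]; norm_num

/-- The one-dimensional module `ℂ^H_{kr}`: `H` acts by `k r`, and `E`, `F` act by zero. -/
def C (r : ℕ) [NeZero r] (k : ℤ) : WeightModule r :=
  stringModule r 1 (k * r) (fun _ => 0) (Nat.one_le_iff_ne_zero.2 (NeZero.ne r)) rfl rfl (by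
    intro l hl
    obtain rfl : l = 0 := by omega
    simp [qint_int_r])

/-! ### Projective modules -/

/-- Indices of the basis of `P_i`: four families, for the letters `H`, `L`, `S`, `R`. -/
abbrev PIdx (r i : ℕ) : Type := (Fin (i + 1) ⊕ Fin (r - 1 - i)) ⊕ (Fin (i + 1) ⊕ Fin (r - 1 - i))

/-- `w^H_{i-2k}` for `0 ≤ k ≤ i` (zero for other `k`). -/
def wH (r i k : ℕ) : PIdx r i →₀ ℂ :=
  if h : k < i + 1 then Finsupp.single (.inl (.inl ⟨k, h⟩)) 1 else 0

/-- `w^L_{-i-2-2k}` for `0 ≤ k ≤ r - 2 - i` (zero for other `k`). -/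
def wL (r i k : ℕ) : PIdx r i →₀ ℂ :=
  if h : k < r - 1 - i then Finsupp.single (.inl (.inr ⟨k, h⟩)) 1 else 0

/-- `w^S_{i-2k}` for `0 ≤ k ≤ i` (zero for other `k`). -/
def wS (r i k : ℕ) : PIdx r i →₀ ℂ :=
  if h : k < i + 1 then Finsupp.single (.inr (.inl ⟨k, h⟩)) 1 else 0

/-- `w^R_{i+2+2k}` for `0 ≤ k ≤ r - 2 - i` (zero for other `k`). -/
def wR (r i k : ℕ) : PIdx r i →₀ ℂ :=
  if h : k < r - 1 - i then Finsupp.single (.inr (.inr ⟨k, h⟩)) 1 else 0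

/-- The weights: the weight of `w^X_m` is `m`. -/
def Pwt (r i : ℕ) : PIdx r i → ℂ
  | .inl (.inl k) => i - 2 * (k : ℕ)
  | .inl (.inr k) => -i - 2 - 2 * (k : ℕ)
  | .inr (.inl k) => i - 2 * (k : ℕ)
  | .inr (.inr k) => i + 2 + 2 * (k : ℕ)

/-- The action of `E` on the basis of `P_i`:
`E w^H_i = w^R_{i+2}`, `E w^H_{i-2k} = [k] [1+i-k] w^H_{i-2(k-1)} + w^S_{i-2(k-1)}`,
`E w^L_{-i-2} = w^S_{-i}`, `E w^L_{-i-2-2k} = -[1+i+k] [k] w^L_{-i-2-2(k-1)}`,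
`E w^S_i = 0`, `E w^S_{i-2k} = [k] [1+i-k] w^S_{i-2(k-1)}`,
`E w^R_{i+2+2k} = w^R_{i+2+2(k+1)}` (zero for the last one). -/
def PE (r i : ℕ) : PIdx r i → PIdx r i →₀ ℂ
  | .inl (.inl ⟨0, _⟩) => wR r i 0
  | .inl (.inl ⟨k + 1, _⟩) => (qint r (k + 1 : ℕ) * qint r (1 + i - (k + 1 : ℕ))) • wH r i k + wS r i k
  | .inl (.inr ⟨0, _⟩) => wS r i i
  | .inl (.inr ⟨k + 1, _⟩) => (-(qint r (1 + i + (k + 1 : ℕ)) * qint r (k + 1 : ℕ))) • wL r i k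
  | .inr (.inl ⟨0, _⟩) => 0
  | .inr (.inl ⟨k + 1, _⟩) => (qint r (k + 1 : ℕ) * qint r (1 + i - (k + 1 : ℕ))) • wS r i k
  | .inr (.inr ⟨k, _⟩) => wR r i (k + 1)

/-- The action of `F` on the basis of `P_i`:
`F w^H_m = w^H_{m-2}` and `F w^H_{-i} = w^L_{-i-2}`, `F w^L_m = w^L_{m-2}` (zero for the last one),
`F w^S_m = w^S_{m-2}` (zero for the last one), `F w^R_{i+2} = w^S_i`,
`F w^R_{i+2+2k} = -[1+i+k] [k] w^R_{i+2+2(k-1)}`. -/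
def PF (r i : ℕ) : PIdx r i → PIdx r i →₀ ℂ
  | .inl (.inl ⟨k, _⟩) => if k = i then wL r i 0 else wH r i (k + 1)
  | .inl (.inr ⟨k, _⟩) => wL r i (k + 1)
  | .inr (.inl ⟨k, _⟩) => wS r i (k + 1)
  | .inr (.inr ⟨0, _⟩) => wS r i 0
  | .inr (.inr ⟨k + 1, _⟩) => (-(qint r (1 + i + (k + 1 : ℕ)) * qint r (k + 1 : ℕ))) • wR r i k

section PMem

variable {r i k : ℕ} {s : Set (PIdx r i)}

theorem wH_mem (h : ∀ hk : k < i + 1, (.inl (.inl ⟨k, hk⟩) : PIdx r i) ∈ s) :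
    wH r i k ∈ Finsupp.supported ℂ ℂ s := by
  unfold wH
  split_ifs with hk
  · exact Finsupp.single_mem_supported ℂ 1 (h hk)
  · exact Submodule.zero_mem _

theorem wL_mem (h : ∀ hk : k < r - 1 - i, (.inl (.inr ⟨k, hk⟩) : PIdx r i) ∈ s) :
    wL r i k ∈ Finsupp.supported ℂ ℂ s := by
  unfold wL
  split_ifs with hk
  · exact Finsupp.single_mem_supported ℂ 1 (h hk)
  · exact Submodule.zero_mem _

theorem wS_mem (h : ∀ hk : k < i + 1, (.inr (.inl ⟨k, hk⟩) : PIdx r i) ∈ s) :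
    wS r i k ∈ Finsupp.supported ℂ ℂ s := by
  unfold wS
  split_ifs with hk
  · exact Finsupp.single_mem_supported ℂ 1 (h hk)
  · exact Submodule.zero_mem _

theorem wR_mem (h : ∀ hk : k < r - 1 - i, (.inr (.inr ⟨k, hk⟩) : PIdx r i) ∈ s) :
    wR r i k ∈ Finsupp.supported ℂ ℂ s := by
  unfold wR
  split_ifs with hk
  · exact Finsupp.single_mem_supported ℂ 1 (h hk)
  · exact Submodule.zero_mem _

theorem op_wH (f : PIdx r i → PIdx r i →₀ ℂ) (hk : k < i + 1) :
    opOf f (wH r i k) = f (.inl (.inl ⟨k, hk⟩)) := by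
  rw [wH, dif_pos hk, opOf_single]

theorem op_wL (f : PIdx r i → PIdx r i →₀ ℂ) (hk : k < r - 1 - i) :
    opOf f (wL r i k) = f (.inl (.inr ⟨k, hk⟩)) := by
  rw [wL, dif_pos hk, opOf_single]

theorem op_wS (f : PIdx r i → PIdx r i →₀ ℂ) (hk : k < i + 1) :
    opOf f (wS r i k) = f (.inr (.inl ⟨k, hk⟩)) := by
  rw [wS, dif_pos hk, opOf_single]

theorem op_wR (f : PIdx r i → PIdx r i →₀ ℂ) (hk : k < r - 1 - i) :
    opOf f (wR r i k) = f (.inr (.inr ⟨k, hk⟩)) := by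
  rw [wR, dif_pos hk, opOf_single]

theorem wS_last : wS r i (i + 1) = 0 := by simp [wS]

end PMem

/-- Witness of the nilpotency of `E` on `P_i`. -/
def PhE (r i : ℕ) : PIdx r i → ℕ
  | .inl (.inl k) => r - 1 - i + k
  | .inl (.inr k) => i + 1 + k
  | .inr (.inl k) => k
  | .inr (.inr k) => r - 2 - i - k

/-- Witness of the nilpotency of `F` on `P_i`. -/
def PhF (r i : ℕ) : PIdx r i → ℕ
  | .inl (.inl k) => r - 1 - k
  | .inl (.inr k) => r - 2 - i - k
  | .inr (.inl k) => i - k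
  | .inr (.inr k) => i + 1 + k

theorem P_E_mem (r i : ℕ) (hi : i + 2 ≤ r) (a : PIdx r i) :
    PE r i a ∈ Finsupp.supported ℂ ℂ {b | Pwt r i b = Pwt r i a + 2 ∧ PhE r i b < PhE r i a} := by
  rcases a with (⟨_ | k, hk⟩ | ⟨_ | k, hk⟩) | (⟨_ | k, hk⟩ | ⟨k, hk⟩)
  · refine wR_mem fun h => ⟨?_, ?_⟩
    · simp [Pwt]
    · simp only [PhE]; omega
  · refine Submodule.add_mem _ (Submodule.smul_mem _ _ (wH_mem fun h => ⟨?_, ?_⟩))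
      (wS_mem fun h => ⟨?_, ?_⟩)
    · simp [Pwt]; ring
    · simp only [PhE]; omega
    · simp [Pwt]; ring
    · simp only [PhE]; omega
  · refine wS_mem fun h => ⟨?_, ?_⟩
    · simp [Pwt]; ring
    · simp only [PhE]; omega
  · refine Submodule.smul_mem _ _ (wL_mem fun h => ⟨?_, ?_⟩)
    · simp [Pwt]; ring
    · simp only [PhE]; omega
  · exact Submodule.zero_mem _
  · refine Submodule.smul_mem _ _ (wS_mem fun h => ⟨?_, ?_⟩)
    · simp [Pwt]; ring
    · simp only [PhE]; omega
  · refine wR_mem fun h => ⟨?_, ?_⟩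
    · simp [Pwt]; ring
    · simp only [PhE]; omega

theorem P_F_mem (r i : ℕ) (hi : i + 2 ≤ r) (a : PIdx r i) :
    PF r i a ∈ Finsupp.supported ℂ ℂ {b | Pwt r i b = Pwt r i a - 2 ∧ PhF r i b < PhF r i a} := by
  rcases a with (⟨k, hk⟩ | ⟨k, hk⟩) | (⟨k, hk⟩ | ⟨_ | k, hk⟩)
  · rw [PF]
    split_ifs with hki
    · subst hki
      refine wL_mem fun h => ⟨?_, ?_⟩
      · simp [Pwt]; ring
      · simp only [PhF]; omega
    · refine wH_mem fun h => ⟨?_, ?_⟩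
      · simp [Pwt]; ring
      · simp only [PhF]; omega
  · refine wL_mem fun h => ⟨?_, ?_⟩
    · simp [Pwt]; ring
    · simp only [PhF]; omega
  · refine wS_mem fun h => ⟨?_, ?_⟩
    · simp [Pwt]; ring
    · simp only [PhF]; omega
  · refine wS_mem fun h => ⟨?_, ?_⟩
    · simp [Pwt]
    · simp only [PhF]; omega
  · refine Submodule.smul_mem _ _ (wR_mem fun h => ⟨?_, ?_⟩)
    · simp [Pwt]; ring
    · simp only [PhF]; omega

theorem P_gamma (r i k : ℕ) :
    qint r (k + 1 : ℕ) * qint r (1 + i - (k + 1 : ℕ)) - qint r k * qint r (1 + i - k)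
      = qint r (i - 2 * k) := by
  have h := qint_mul_sub r k (k - i - 1)
  rw [show (1 : ℂ) + i - (k + 1 : ℕ) = -(k - i - 1 + 1) by push_cast; ring,
    show (1 : ℂ) + i - k = -(k - i - 1) by ring, qint_neg, qint_neg,
    show (i : ℂ) - 2 * k = -(k + (k - i - 1) + 1) by ring, qint_neg, ← h]
  push_cast
  ring

theorem P_delta (r i k : ℕ) :
    -(qint r (1 + i + (k + 1 : ℕ)) * qint r (k + 1 : ℕ)) - -(qint r (1 + i + k) * qint r k)
      = qint r (-i - 2 - 2 * k) := by
  have h := qint_mul_sub r (1 + i + k) k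
  rw [show (-i - 2 - 2 * k : ℂ) = -(1 + i + k + k + 1) by ring, qint_neg, ← h,
    show (1 : ℂ) + i + (k + 1 : ℕ) = 1 + i + k + 1 by push_cast; ring]
  push_cast
  ring

theorem P_delta_last (r i k : ℕ) (hi : i + 2 ≤ r) (hk : k + 1 = r - 1 - i) :
    -(qint r (1 + i + (k + 1 : ℕ)) * qint r (k + 1 : ℕ)) = 0 := by
  have : NeZero r := ⟨by omega⟩
  have h : (1 : ℂ) + i + (k + 1 : ℕ) = r := by
    have : 1 + i + (k + 1) = r := by omega
    exact_mod_cast this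
  rw [h, qint_r, zero_mul, neg_zero]

theorem PE_wL (r i k : ℕ) (hi : i + 2 ≤ r) (hk : k < r - 1 - i) :
    opOf (PE r i) (wL r i (k + 1))
      = (-(qint r (1 + i + (k + 1 : ℕ)) * qint r (k + 1 : ℕ))) • wL r i k := by
  rcases Nat.lt_or_ge (k + 1) (r - 1 - i) with h | h
  · rw [op_wL _ h]; rfl
  · rw [P_delta_last r i k hi (by omega), zero_smul, wL, dif_neg (by omega), map_zero]

theorem PF_wR (r i k : ℕ) (hi : i + 2 ≤ r) (hk : k < r - 1 - i) :
    opOf (PF r i) (wR r i (k + 1))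
      = (-(qint r (1 + i + (k + 1 : ℕ)) * qint r (k + 1 : ℕ))) • wR r i k := by
  rcases Nat.lt_or_ge (k + 1) (r - 1 - i) with h | h
  · rw [op_wR _ h]; rfl
  · rw [P_delta_last r i k hi (by omega), zero_smul, wR, dif_neg (by omega), map_zero]

theorem PE_wS (r i k : ℕ) (hk : k < i + 1) :
    opOf (PE r i) (wS r i (k + 1))
      = (qint r (k + 1 : ℕ) * qint r (1 + i - (k + 1 : ℕ))) • wS r i k := by
  rcases Nat.lt_or_ge (k + 1) (i + 1) with h | h
  · rw [op_wS _ h]; rfl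
  · obtain rfl : k = i := by omega
    rw [wS_last, map_zero, show (1 : ℂ) + k - (k + 1 : ℕ) = 0 by push_cast; ring, qint_zero,
      mul_zero, zero_smul]

theorem PE_PF_H (r i k : ℕ) (hi : i + 2 ≤ r) (hk : k < i + 1) :
    opOf (PE r i) (PF r i (.inl (.inl ⟨k, hk⟩)))
      = (qint r (k + 1 : ℕ) * qint r (1 + i - (k + 1 : ℕ))) • wH r i k + wS r i k := by
  rw [PF]
  split_ifs with h
  · subst h
    rw [op_wL _ (by omega), show (1 : ℂ) + k - (k + 1 : ℕ) = 0 by push_cast; ring, qint_zero,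
      mul_zero, zero_smul, zero_add]
    rfl
  · rw [op_wH _ (show k + 1 < i + 1 by omega)]; rfl

theorem P_EF (r i : ℕ) (hi : i + 2 ≤ r) (a : PIdx r i) :
    opOf (PE r i) (PF r i a) - opOf (PF r i) (PE r i a)
      = qint r (Pwt r i a) • Finsupp.single a 1 := by
  rcases a with (⟨k, hk⟩ | ⟨k, hk⟩) | (⟨k, hk⟩ | ⟨k, hk⟩)
  · have hs : Finsupp.single (.inl (.inl ⟨k, hk⟩) : PIdx r i) (1 : ℂ) = wH r i k := by
      rw [wH, dif_pos hk]
    rw [hs, PE_PF_H r i k hi hk, show Pwt r i (.inl (.inl ⟨k, hk⟩)) = i - 2 * (k : ℂ) from rfl,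
      ← P_gamma]
    rcases k with _ | k
    · have e : opOf (PF r i) (PE r i (.inl (.inl ⟨0, hk⟩))) = wS r i 0 :=
        op_wR _ (show 0 < r - 1 - i by omega)
      rw [e, Nat.cast_zero, qint_zero, zero_mul, sub_zero, add_sub_cancel_right]
    · have e : opOf (PF r i) (PE r i (.inl (.inl ⟨k + 1, hk⟩)))
          = (qint r (k + 1 : ℕ) * qint r (1 + i - (k + 1 : ℕ))) • wH r i (k + 1)
            + wS r i (k + 1) := by
        rw [PE, map_add, map_smul, op_wH _ (show k < i + 1 by omega),
          op_wS _ (show k < i + 1 by omega), PF, if_neg (by omega)]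
        rfl
      rw [e, sub_smul]; abel
  · have hs : Finsupp.single (.inl (.inr ⟨k, hk⟩) : PIdx r i) (1 : ℂ) = wL r i k := by
      rw [wL, dif_pos hk]
    have e1 : opOf (PE r i) (PF r i (.inl (.inr ⟨k, hk⟩))) = _ := PE_wL r i k hi hk
    rw [hs, e1, show Pwt r i (.inl (.inr ⟨k, hk⟩)) = -i - 2 - 2 * (k : ℂ) from rfl, ← P_delta]
    rcases k with _ | k
    · have e : opOf (PF r i) (PE r i (.inl (.inr ⟨0, hk⟩))) = 0 :=
        (op_wS _ (show i < i + 1 by omega)).trans wS_last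
      rw [e, Nat.cast_zero, qint_zero, mul_zero, neg_zero, sub_zero, sub_zero]
    · have e : opOf (PF r i) (PE r i (.inl (.inr ⟨k + 1, hk⟩)))
          = (-(qint r (1 + i + (k + 1 : ℕ)) * qint r (k + 1 : ℕ))) • wL r i (k + 1) := by
        rw [PE, map_smul, op_wL _ (show k < r - 1 - i by omega)]; rfl
      rw [e, sub_smul]
  · have hs : Finsupp.single (.inr (.inl ⟨k, hk⟩) : PIdx r i) (1 : ℂ) = wS r i k := by
      rw [wS, dif_pos hk]
    have e1 : opOf (PE r i) (PF r i (.inr (.inl ⟨k, hk⟩))) = _ := PE_wS r i k hk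
    rw [hs, e1, show Pwt r i (.inr (.inl ⟨k, hk⟩)) = i - 2 * (k : ℂ) from rfl, ← P_gamma]
    rcases k with _ | k
    · have e : opOf (PF r i) (PE r i (.inr (.inl ⟨0, hk⟩))) = 0 := map_zero _
      rw [e, Nat.cast_zero, qint_zero, zero_mul, sub_zero, sub_zero]
    · have e : opOf (PF r i) (PE r i (.inr (.inl ⟨k + 1, hk⟩)))
          = (qint r (k + 1 : ℕ) * qint r (1 + i - (k + 1 : ℕ))) • wS r i (k + 1) := by
        rw [PE, map_smul, op_wS _ (show k < i + 1 by omega)]; rfl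
      rw [e, sub_smul]
  · have hs : Finsupp.single (.inr (.inr ⟨k, hk⟩) : PIdx r i) (1 : ℂ) = wR r i k := by
      rw [wR, dif_pos hk]
    have e1 : opOf (PF r i) (PE r i (.inr (.inr ⟨k, hk⟩))) = _ := PF_wR r i k hi hk
    rw [hs, e1, show Pwt r i (.inr (.inr ⟨k, hk⟩)) = -(-i - 2 - 2 * (k : ℂ)) by
      simp only [Pwt]; ring, qint_neg, ← P_delta]
    rcases k with _ | k
    · have e : opOf (PE r i) (PF r i (.inr (.inr ⟨0, hk⟩))) = 0 :=
        op_wS _ (show 0 < i + 1 by omega)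
      rw [e, Nat.cast_zero, qint_zero, mul_zero, neg_zero, sub_zero, zero_sub, ← neg_smul]
    · have e : opOf (PE r i) (PF r i (.inr (.inr ⟨k + 1, hk⟩)))
          = (-(qint r (1 + i + (k + 1 : ℕ)) * qint r (k + 1 : ℕ))) • wR r i (k + 1) := by
        rw [PF, map_smul, op_wR _ (show k < r - 1 - i by omega)]; rfl
      rw [e, ← sub_smul]; congr 1; ring

/-- The basis of `P_i` with its weights and the action of `E` and `F`. -/
def Pdata (r i : ℕ) (hi : i + 2 ≤ r) : BasisData r (PIdx r i) where
  wt := Pwt r i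
  E := PE r i
  F := PF r i
  hE := PhE r i
  hF := PhF r i
  hE_lt := by rintro ((⟨k, hk⟩ | ⟨k, hk⟩) | (⟨k, hk⟩ | ⟨k, hk⟩)) <;> simp only [PhE] <;> omega
  hF_lt := by rintro ((⟨k, hk⟩ | ⟨k, hk⟩) | (⟨k, hk⟩ | ⟨k, hk⟩)) <;> simp only [PhF] <;> omega
  E_mem := P_E_mem r i hi
  F_mem := P_F_mem r i hi
  EF := P_EF r i hi

/-- The projective cover `P_i` of `S_i`, for `0 ≤ i ≤ r - 2`, of dimension `2 r`. -/
def P (r i : ℕ) (hi : i + 2 ≤ r) : WeightModule r := (Pdata r i hi).toWeightModule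

theorem P_gen (r i : ℕ) (hi : i + 2 ≤ r) (g : Gen) : (P r i hi).ρ (gen r g)
    = genMap (opOf (PE r i)) (opOf (PF r i)) (diagOp fun a => qpow r (Pwt r i a))
      (diagOp fun a => qpow r (-Pwt r i a)) (diagOp (Pwt r i)) g :=
  liftU_gen (Pdata r i hi).relations g

/-- `x_i` on the basis of `P_i`: `w^H_m ↦ w^S_m`, all other basis vectors to zero. -/
def xFun (r i : ℕ) : PIdx r i → PIdx r i →₀ ℂ
  | .inl (.inl ⟨k, _⟩) => wS r i k
  | .inl (.inr _) => 0
  | .inr (.inl _) => 0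
  | .inr (.inr _) => 0

theorem x_wH (r i k : ℕ) : opOf (xFun r i) (wH r i k) = wS r i k := by
  rcases Nat.lt_or_ge k (i + 1) with h | h
  · rw [op_wH _ h]; rfl
  · rw [wH, dif_neg (by omega), wS, dif_neg (by omega), map_zero]

theorem x_wL (r i k : ℕ) : opOf (xFun r i) (wL r i k) = 0 := by
  rcases Nat.lt_or_ge k (r - 1 - i) with h | h
  · rw [op_wL _ h]; rfl
  · rw [wL, dif_neg (by omega), map_zero]

theorem x_wS (r i k : ℕ) : opOf (xFun r i) (wS r i k) = 0 := by
  rcases Nat.lt_or_ge k (i + 1) with h | h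
  · rw [op_wS _ h]; rfl
  · rw [wS, dif_neg (by omega), map_zero]

theorem x_wR (r i k : ℕ) : opOf (xFun r i) (wR r i k) = 0 := by
  rcases Nat.lt_or_ge k (r - 1 - i) with h | h
  · rw [op_wR _ h]; rfl
  · rw [wR, dif_neg (by omega), map_zero]

theorem x_PE (r i : ℕ) : opOf (xFun r i) ∘ₗ opOf (PE r i) = opOf (PE r i) ∘ₗ opOf (xFun r i) := by
  refine op_ext fun a => ?_
  rw [LinearMap.comp_apply, LinearMap.comp_apply, opOf_single, opOf_single]
  rcases a with (⟨_ | k, hk⟩ | ⟨_ | k, hk⟩) | (⟨_ | k, hk⟩ | ⟨k, hk⟩)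
  · rw [PE, x_wR, xFun, op_wS _ hk]; rfl
  · rw [PE, map_add, map_smul, x_wH, x_wS, add_zero, xFun, op_wS _ hk]; rfl
  · rw [PE, x_wS, xFun, map_zero]
  · rw [PE, map_smul, x_wL, smul_zero, xFun, map_zero]
  · rw [PE, xFun, map_zero, map_zero]
  · rw [PE, map_smul, x_wS, smul_zero, xFun, map_zero]
  · rw [PE, x_wR, xFun, map_zero]

theorem x_PF (r i : ℕ) : opOf (xFun r i) ∘ₗ opOf (PF r i) = opOf (PF r i) ∘ₗ opOf (xFun r i) := by
  refine op_ext fun a => ?_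
  rw [LinearMap.comp_apply, LinearMap.comp_apply, opOf_single, opOf_single]
  rcases a with (⟨k, hk⟩ | ⟨k, hk⟩) | (⟨k, hk⟩ | ⟨_ | k, hk⟩)
  · rw [PF, xFun, op_wS _ hk, PF]
    split_ifs with h
    · rw [x_wL, h, wS_last]
    · rw [x_wH]
  · rw [PF, x_wL, xFun, map_zero]
  · rw [PF, x_wS, xFun, map_zero]
  · rw [PF, x_wS, xFun, map_zero]
  · rw [PF, map_smul, x_wR, smul_zero, xFun, map_zero]

theorem x_diag (r i : ℕ) (c : ℂ → ℂ) :
    opOf (xFun r i) ∘ₗ diagOp (fun a => c (Pwt r i a))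
      = diagOp (fun a => c (Pwt r i a)) ∘ₗ opOf (xFun r i) := by
  refine op_ext fun a => ?_
  rw [LinearMap.comp_apply, LinearMap.comp_apply, diagOp_single, map_smul, opOf_single]
  rcases a with (⟨k, hk⟩ | ⟨k, hk⟩) | (⟨k, hk⟩ | ⟨k, hk⟩)
  · rw [xFun]
    have h : wS r i k ∈ Finsupp.supported ℂ ℂ
        {b | (fun a => c (Pwt r i a)) b = c (Pwt r i (.inl (.inl ⟨k, hk⟩)))} :=
      wS_mem fun _ => rfl
    exact (diagOp_of_supported h).symm
  · rw [xFun, map_zero, smul_zero]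
  · rw [xFun, map_zero, smul_zero]
  · rw [xFun, map_zero, smul_zero]

/-- The nilpotent endomorphism `x_i` of `P_i`. -/
def xP (r i : ℕ) (hi : i + 2 ≤ r) : WeightModule.Hom (P r i hi) (P r i hi) :=
  WeightModule.Hom.ofGen (V := P r i hi) (W := P r i hi) (opOf (xFun r i)) (by
    intro g
    rw [P_gen]
    cases g
    · exact x_PE r i
    · exact x_PF r i
    · exact x_diag r i (qpow r)
    · exact x_diag r i (fun z => qpow r (-z))
    · exact x_diag r i (fun z => z))

/-- The nilpotent endomorphism `x_{i,k} = x_i ⊗ Id` of `P_i ⊗ ℂ^H_{kr}`. It is determined by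
`w^H_i ⊗ v ↦ w^S_i ⊗ v`, where `v` spans `ℂ^H_{kr}`; see `xPC_apply` and `xPC_unique`. -/
def xPC (r i : ℕ) [NeZero r] (hi : i + 2 ≤ r) (k : ℤ) :
    WeightModule.Hom ((P r i hi).tensor (C r k)) ((P r i hi).tensor (C r k)) :=
  (xP r i hi).tensorId (C r k)

/-- The basis vector `v` of `ℂ^H_{kr}`. -/
def Cvec (r : ℕ) [NeZero r] (k : ℤ) : (C r k).carrier := vec 1 0

/-- The vector `w ⊗ v` of `P_i ⊗ ℂ^H_{kr}`, where `v` spans `ℂ^H_{kr}`. -/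
def tmulC (r i : ℕ) [NeZero r] (hi : i + 2 ≤ r) (k : ℤ) :
    (PIdx r i →₀ ℂ) →ₗ[ℂ] ((P r i hi).tensor (C r k)).carrier :=
  (TensorProduct.mk ℂ (P r i hi).carrier (C r k).carrier).flip (Cvec r k)

theorem xPC_apply (r i : ℕ) [NeZero r] (hi : i + 2 ≤ r) (k : ℤ) (m : ℕ) :
    (xPC r i hi k).toLin (tmulC r i hi k (wH r i m)) = tmulC r i hi k (wS r i m) := by
  have h : (xPC r i hi k).toLin (tmulC r i hi k (wH r i m))
      = tmulC r i hi k (opOf (xFun r i) (wH r i m)) := rfl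
  rw [h, x_wH]

theorem C_E (r : ℕ) [NeZero r] (k : ℤ) : (C r k).ρ (gen r .E) (Cvec r k) = 0 :=
  (LinearMap.congr_fun (liftU_gen (BasisData.relations _) .E) (vec 1 0)).trans
    ((opOf_vec _ 0).trans ((dif_pos Nat.one_pos).trans (zero_smul _ _)))

theorem C_F (r : ℕ) [NeZero r] (k : ℤ) : (C r k).ρ (gen r .F) (Cvec r k) = 0 :=
  (LinearMap.congr_fun (liftU_gen (BasisData.relations _) .F) (vec 1 0)).trans
    ((opOf_vec _ 0).trans ((dif_pos Nat.one_pos).trans (by simp [vec]; rfl)))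

theorem C_K (r : ℕ) [NeZero r] (k : ℤ) :
    (C r k).ρ (gen r .K) (Cvec r k) = qpow r (k * r) • Cvec r k := by
  refine (LinearMap.congr_fun (liftU_gen (BasisData.relations _) .K) (vec 1 0)).trans ?_
  have h : vec 1 0 = Finsupp.single (0 : Fin 1) (1 : ℂ) := by simp [vec]
  rw [Cvec, h]
  refine (diagOp_single _ _).trans
    (congrArg (fun z => qpow r z • Finsupp.single (0 : Fin 1) (1 : ℂ)) ?_)
  simp

theorem tmulC_F (r i : ℕ) [NeZero r] (hi : i + 2 ≤ r) (k : ℤ) (w : PIdx r i →₀ ℂ) :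
    ((P r i hi).tensor (C r k)).ρ (gen r .F) (tmulC r i hi k w)
      = tmulC r i hi k (opOf (PF r i) w) := by
  refine (WeightModule.tensor_F_tmul (P r i hi) (C r k) w (Cvec r k)).trans ?_
  rw [C_F, TensorProduct.tmul_zero, zero_add, P_gen]
  rfl

theorem tmulC_E (r i : ℕ) [NeZero r] (hi : i + 2 ≤ r) (k : ℤ) (w : PIdx r i →₀ ℂ) :
    ((P r i hi).tensor (C r k)).ρ (gen r .E) (tmulC r i hi k w)
      = qpow r (k * r) • tmulC r i hi k (opOf (PE r i) w) := by
  have key : ∀ v : (P r i hi).carrier, ((P r i hi).tensor (C r k)).ρ (gen r .E)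
      (v ⊗ₜ[ℂ] Cvec r k : (P r i hi).carrier ⊗[ℂ] (C r k).carrier)
      = (qpow r (k * r) • ((P r i hi).ρ (gen r .E) v ⊗ₜ[ℂ] Cvec r k) :
        (P r i hi).carrier ⊗[ℂ] (C r k).carrier) := by
    intro v
    rw [WeightModule.tensor_E_tmul, C_E, TensorProduct.tmul_zero, zero_add, C_K,
      TensorProduct.tmul_smul]
  refine (key w).trans ?_
  rw [P_gen]
  rfl

theorem xPC_unique (r i : ℕ) [NeZero r] (hi : i + 2 ≤ r) (k : ℤ)
    (f : WeightModule.Hom ((P r i hi).tensor (C r k)) ((P r i hi).tensor (C r k)))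
    (hf : f.toLin (tmulC r i hi k (wH r i 0)) = tmulC r i hi k (wS r i 0)) :
    f = xPC r i hi k := by
  have hq : qpow r (k * r) ≠ 0 := Complex.exp_ne_zero _
  let Q : (PIdx r i →₀ ℂ) → Prop := fun w =>
    f.toLin (tmulC r i hi k w) = (xPC r i hi k).toLin (tmulC r i hi k w)
  have Q0 : Q (wH r i 0) := hf.trans (xPC_apply r i hi k 0).symm
  have QF : ∀ w, Q w → Q (opOf (PF r i) w) := by
    intro w hw
    have e1 := LinearMap.congr_fun (f.comm (gen r .F)) (tmulC r i hi k w)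
    have e2 := LinearMap.congr_fun ((xPC r i hi k).comm (gen r .F)) (tmulC r i hi k w)
    simp only [LinearMap.comp_apply, tmulC_F] at e1 e2
    change f.toLin _ = (xPC r i hi k).toLin _
    rw [e1, e2, show f.toLin (tmulC r i hi k w) = _ from hw]
  have QE : ∀ w, Q w → Q (opOf (PE r i) w) := by
    intro w hw
    have e1 := LinearMap.congr_fun (f.comm (gen r .E)) (tmulC r i hi k w)
    have e2 := LinearMap.congr_fun ((xPC r i hi k).comm (gen r .E)) (tmulC r i hi k w)
    simp only [LinearMap.comp_apply, tmulC_E, map_smul] at e1 e2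
    rw [show f.toLin (tmulC r i hi k w) = _ from hw, ← e2] at e1
    exact smul_right_injective _ hq e1
  have QH : ∀ m (hm : m < i + 1), Q (wH r i m) := by
    intro m
    induction m with
    | zero => exact fun _ => Q0
    | succ m ih =>
      intro hm
      have h := QF _ (ih (by omega))
      rwa [op_wH _ (show m < i + 1 by omega), PF, if_neg (by omega)] at h
  have QL : ∀ m (hm : m < r - 1 - i), Q (wL r i m) := by
    intro m
    induction m with
    | zero =>
      intro hm
      have h := QF _ (QH i (by omega))
      rwa [op_wH _ (show i < i + 1 by omega), PF, if_pos rfl] at h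
    | succ m ih =>
      intro hm
      have h := QF _ (ih (by omega))
      rwa [op_wL _ (show m < r - 1 - i by omega), PF] at h
  have QR : ∀ m (hm : m < r - 1 - i), Q (wR r i m) := by
    intro m
    induction m with
    | zero =>
      intro hm
      have h := QE _ Q0
      rwa [op_wH _ (show 0 < i + 1 by omega), PE] at h
    | succ m ih =>
      intro hm
      have h := QE _ (ih (by omega))
      rwa [op_wR _ (show m < r - 1 - i by omega), PE] at h
  have QS : ∀ m (hm : m < i + 1), Q (wS r i m) := by
    intro m
    induction m with
    | zero =>
      intro hm
      have h := QF _ (QR 0 (by omega))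
      rwa [op_wR _ (show 0 < r - 1 - i by omega), PF] at h
    | succ m ih =>
      intro hm
      have h := QF _ (ih (by omega))
      rwa [op_wS _ (show m < i + 1 by omega), PF] at h
  have Qall : ∀ a : PIdx r i, Q (Finsupp.single a 1) := by
    rintro ((⟨m, hm⟩ | ⟨m, hm⟩) | (⟨m, hm⟩ | ⟨m, hm⟩))
    · have h := QH m hm; rwa [wH, dif_pos hm] at h
    · have h := QL m hm; rwa [wL, dif_pos hm] at h
    · have h := QS m hm; rwa [wS, dif_pos hm] at h
    · have h := QR m hm; rwa [wR, dif_pos hm] at h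
  have hlin : f.toLin = (xPC r i hi k).toLin := by
    have h2 : f.toLin ∘ₗ tmulC r i hi k = (xPC r i hi k).toLin ∘ₗ tmulC r i hi k :=
      Finsupp.lhom_ext' fun a => LinearMap.ext_ring (Qall a)
    refine TensorProduct.ext' (M := (P r i hi).carrier) (N := (C r k).carrier) fun w v => ?_
    obtain ⟨c, rfl⟩ : ∃ c : ℂ, v = c • Cvec r k := by
      refine ⟨(show Fin 1 →₀ ℂ from v) 0, ?_⟩
      change (show Fin 1 →₀ ℂ from v) = (show Fin 1 →₀ ℂ from v) 0 • vec 1 0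
      refine Finsupp.ext fun a => ?_
      obtain rfl : a = 0 := Subsingleton.elim _ _
      simp [vec]
    have e : (w ⊗ₜ[ℂ] (c • Cvec r k) : (P r i hi).carrier ⊗[ℂ] (C r k).carrier)
        = c • tmulC r i hi k w := TensorProduct.tmul_smul c w _
    rw [e]
    refine (map_smul f.toLin _ _).trans (Eq.trans ?_ (map_smul (xPC r i hi k).toLin _ _).symm)
    exact congrArg _ (LinearMap.congr_fun h2 w)
  cases f
  cases h : xPC r i hi k
  rw [h] at hlin
  simp only at hlin
  subst hlin
  rfl

/-! ### Braiding, (co)evaluation and open Hopf links -/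

namespace WeightModule

variable {r : ℕ}

/-- `q ^ (H ⊗ H / 2)` on `V ⊗ W`. -/
def qHH (V W : WeightModule r) : Module.End ℂ (V.carrier ⊗[ℂ] W.carrier) :=
  diagFun (TensorProduct.map (V.ρ (gen r .H)) (W.ρ (gen r .H))) fun z => qpow r (z / 2)

/-- The action on `V ⊗ W` of the universal `R`-matrix
`R = q ^ (H ⊗ H / 2) ∑_{n < r} ({1}^{2n} / {n}!) q ^ (n (n - 1) / 2) E^n ⊗ F^n`. -/
def rMatrix (V W : WeightModule r) : Module.End ℂ (V.carrier ⊗[ℂ] W.carrier) :=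
  qHH V W * ∑ n ∈ Finset.range r,
    (br r 1 ^ (2 * n) / brFact r n * qpow r ((n : ℂ) * ((n : ℂ) - 1) / 2)) •
      TensorProduct.map (V.ρ (gen r .E ^ n)) (W.ρ (gen r .F ^ n))

/-- The braiding `c_{V,W} : V ⊗ W → W ⊗ V`: the `R`-matrix followed by the flip. -/
def braiding (V W : WeightModule r) : V.carrier ⊗[ℂ] W.carrier →ₗ[ℂ] W.carrier ⊗[ℂ] V.carrier :=
  (TensorProduct.comm ℂ V.carrier W.carrier).toLinearMap ∘ₗ rMatrix V W

/-- The left coevaluation `ℂ → V ⊗ V*`, `1 ↦ ∑ v_j ⊗ v_j*`. -/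
def coev (V : WeightModule r) : ℂ →ₗ[ℂ] V.carrier ⊗[ℂ] Module.Dual ℂ V.carrier :=
  coevaluation ℂ V.carrier

/-- The right evaluation `V ⊗ V* → ℂ`, `v ⊗ f ↦ f (K^{1-r} v)`. -/
def ev' (V : WeightModule r) : V.carrier ⊗[ℂ] Module.Dual ℂ V.carrier →ₗ[ℂ] ℂ :=
  TensorProduct.lift (LinearMap.flip
    ((LinearMap.llcomp ℂ V.carrier V.carrier ℂ).flip (V.ρ (gen r .Kinv ^ (r - 1)))))

theorem ev'_tmul (V : WeightModule r) (v : V.carrier) (f : Module.Dual ℂ V.carrier) :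
    ev' V (v ⊗ₜ f) = f (V.ρ (gen r .Kinv ^ (r - 1)) v) := rfl

/-- The open Hopf link
`Φ_{V,W} = (Id_W ⊗ ev'_V) (c_{V,W} ⊗ Id_{V*}) (c_{W,V} ⊗ Id_{V*}) (Id_W ⊗ coev_V)`. -/
def hopf (V W : WeightModule r) : Module.End ℂ W.carrier :=
  (TensorProduct.rid ℂ W.carrier).toLinearMap ∘ₗ
    (ev' V).lTensor W.carrier ∘ₗ
    (TensorProduct.assoc ℂ W.carrier V.carrier (Module.Dual ℂ V.carrier)).toLinearMap ∘ₗ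
    (braiding V W).rTensor (Module.Dual ℂ V.carrier) ∘ₗ
    (braiding W V).rTensor (Module.Dual ℂ V.carrier) ∘ₗ
    (TensorProduct.assoc ℂ W.carrier V.carrier (Module.Dual ℂ V.carrier)).symm.toLinearMap ∘ₗ
    (coev V).lTensor W.carrier ∘ₗ
    (TensorProduct.rid ℂ W.carrier).symm.toLinearMap

end WeightModule

end

end UnrolledSl2

/-!
Write `Q_s = q ^ (s H)` and let `V` be any colour. The double braiding is a sum of terms
`F^m E^n ⊗ (⋯ E^m ⋯ F^n)`, and in the partial trace over `V` only `m = n` survives, because the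
other operators on `V` shift the weight (`trace_eq_zero_of_commutator`). So on a vector `w` of
weight `μ` the open Hopf link acts as `∑_n C_n(μ) F^n E^n w` (`hopf_apply`), where `C_n(μ)` is, up
to an explicit factor, the trace of `Q_{μ + n + 1 - r} E^n F^n` on `V`.

Cyclicity of the trace gives a relation between these traces for `n` and `n + 1`
(`br_mul_qTrace_succ`), equivalently `C_n(μ) - C_n(μ - 2) = C_{n+1}(μ - 2) [n + 1] [μ + n]`
(`hopfCoeff_sub`). This one relation does two things.

* It makes the open Hopf link commute with `E` and `F`, so that it is a module endomorphism
  (`hopfHom`) and on `P_j ⊗ ℂ^H_{lr}` is determined by its value at the generator `w^H_j ⊗ v`.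
  That value is `C_0(μ₀) (w^H_j ⊗ v) + b (w^S_j ⊗ v)` with `μ₀ = j + l r`, where `b` is a sum over
  `n ≥ 1` of `C_n(μ₀)` times the structure constants of `P_j`.
* It says that a highest weight vector and its `m`-th descendant receive the same scalar, for
  every complex highest weight (`sum_hopfCoeff_mul_prod`):
  `C_0(μ + 2 m) = ∑_{n ≤ m} C_n(μ) ∏_{k < n} [m - k] [μ + m + 1 + k]`. For `m = r - 1 - j` every
  term with `n ≥ 1` has the factor `[μ + m + 1]`, which vanishes at `μ = μ₀`. Differentiating
  there gives `b` in terms of the derivative of `C_0` at two points (`sum_hopfCoeff_nilpotent`),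
  and `C_0` is a character of `V`.

Both scalars are therefore sums over the weights `ν` of the colour alone (`hopf_P_tensor_C`):
`a = ∑ q ^ (x ν)` and `b = {1} / (2 [j + 1]) ∑ ν (q ^ (x ν) - q ^ (y ν))` with
`x = j + 1 + (l - 1) r` and `y = -(j + 1) + (l + 1) r`. For the three families of colours these
are geometric sums and their derivatives.
-/

namespace UnrolledSl2

noncomputable section

/-! ### Quantum integers -/

theorem qpow_ne_zero (r : ℕ) (z : ℂ) : qpow r z ≠ 0 := Complex.exp_ne_zero _

theorem qpow_neg (r : ℕ) (z : ℂ) : qpow r (-z) = (qpow r z)⁻¹ :=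
  eq_inv_of_mul_eq_one_left (qpow_neg_mul r z)

theorem qpow_nat_mul (r n : ℕ) (z : ℂ) : qpow r (n * z) = qpow r z ^ n := by
  rw [qpow, qpow, ← Complex.exp_nat_mul]; congr 1; ring

theorem br_ne_zero {r n : ℕ} (h0 : 0 < n) (hn : n < r) : br r n ≠ 0 := by
  intro h
  have h1 : qpow r 2 ^ n = 1 := by
    rw [← qpow_nat_mul, mul_two, qpow_add]
    nth_rw 2 [sub_eq_zero.1 h]
    exact qpow_mul_neg r n
  exact (qpow_two_primitive r (by omega)).pow_ne_one_of_pos_of_lt h0.ne' hn h1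

theorem br_one_ne_zero {r : ℕ} (hr : 2 ≤ r) : br r 1 ≠ 0 := by
  simpa using br_ne_zero (r := r) (n := 1) one_pos (by omega)

theorem qint_ne_zero {r n : ℕ} (h0 : 0 < n) (hn : n < r) : qint r n ≠ 0 :=
  div_ne_zero (br_ne_zero h0 hn) (br_one_ne_zero (by omega))

theorem qint_one_mul (r : ℕ) (z : ℂ) : qint r 1 * qint r z = qint r z := by
  have h := qint_mul_sub r 0 (z - 1)
  rwa [qint_zero, zero_mul, sub_zero, zero_add, zero_add, sub_add_cancel] at h

theorem br_neg (r : ℕ) (z : ℂ) : br r (-z) = -br r z := by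
  simp only [br, neg_neg]; ring

/-- Translating the argument of `{·}` by a multiple `k r` only changes the sign. -/
theorem br_add_int_mul_r (r : ℕ) [NeZero r] (z : ℂ) (k : ℤ) :
    br r (z + k * r) = (-1) ^ k * br r z := by
  have h : qpow r (-(k * r)) = (-1) ^ k := by
    rw [← neg_mul, ← Int.cast_neg, qpow_int_r r (NeZero.ne r)]
    rcases Int.even_or_odd k with hk | hk
    · rw [hk.neg_one_zpow, hk.neg.neg_one_zpow]
    · rw [hk.neg_one_zpow, hk.neg.neg_one_zpow]
  rw [br, br, neg_add, qpow_add, qpow_add, h, qpow_int_r r (NeZero.ne r)]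
  ring

theorem qint_add_int_mul_r (r : ℕ) [NeZero r] (z : ℂ) (k : ℤ) :
    qint r (z + k * r) = (-1) ^ k * qint r z := by
  rw [qint, qint, br_add_int_mul_r, mul_div_assoc]

/-! ### Functions of the weight -/

namespace WeightModule

variable {r : ℕ}

/-- Linear maps that agree on weight vectors are equal. -/
theorem ext_weight (V : WeightModule r) {M : Type*} [AddCommGroup M] [Module ℂ M]
    {f g : V.carrier →ₗ[ℂ] M}
    (h : ∀ (μ : ℂ) (v : V.carrier), V.ρ (gen r .H) v = μ • v → f v = g v) : f = g :=
  LinearMap.ext_on V.span_weight fun v ⟨μ, hv⟩ => h μ v hv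

/-- The operator that acts as `φ μ` on the vectors of weight `μ`. -/
def wtOp (V : WeightModule r) (φ : ℂ → ℂ) : Module.End ℂ V.carrier := diagFun (V.ρ (gen r .H)) φ

/-- The operator `q ^ (s H)`. -/
def qH (V : WeightModule r) (s : ℂ) : Module.End ℂ V.carrier := V.wtOp fun ν => qpow r (s * ν)

section

variable {V : WeightModule r} {μ : ℂ} {v : V.carrier}

theorem wtOp_apply (φ : ℂ → ℂ) (hv : V.ρ (gen r .H) v = μ • v) : V.wtOp φ v = φ μ • v :=
  diagFun_apply _ _ hv

theorem qH_apply (s : ℂ) (hv : V.ρ (gen r .H) v = μ • v) : V.qH s v = qpow r (s * μ) • v :=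
  wtOp_apply _ hv

theorem wt_E (hv : V.ρ (gen r .H) v = μ • v) :
    V.ρ (gen r .H) (V.ρ (gen r .E) v) = (μ + 2) • V.ρ (gen r .E) v := by
  have h := LinearMap.congr_fun (congrArg V.ρ (gen_relations r).HE) v
  simp only [map_sub, map_mul, map_smul, LinearMap.sub_apply, Module.End.mul_apply,
    LinearMap.smul_apply, hv] at h
  rw [sub_eq_iff_eq_add.1 h, add_smul, add_comm]

theorem wt_F (hv : V.ρ (gen r .H) v = μ • v) :
    V.ρ (gen r .H) (V.ρ (gen r .F) v) = (μ - 2) • V.ρ (gen r .F) v := by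
  have h := LinearMap.congr_fun (congrArg V.ρ (gen_relations r).HF) v
  simp only [map_sub, map_mul, map_smul, LinearMap.sub_apply, Module.End.mul_apply,
    LinearMap.smul_apply, hv] at h
  rw [sub_eq_iff_eq_add.1 h, sub_eq_add_neg, add_smul, add_comm]

theorem wt_E_pow (n : ℕ) (hv : V.ρ (gen r .H) v = μ • v) :
    V.ρ (gen r .H) (V.ρ (gen r .E ^ n) v) = (μ + 2 * n) • V.ρ (gen r .E ^ n) v := by
  induction n with
  | zero => simpa using hv
  | succ n ih =>
    rw [pow_succ', map_mul, Module.End.mul_apply, wt_E ih]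
    congr 1; push_cast; ring

theorem wt_F_pow (n : ℕ) (hv : V.ρ (gen r .H) v = μ • v) :
    V.ρ (gen r .H) (V.ρ (gen r .F ^ n) v) = (μ - 2 * n) • V.ρ (gen r .F ^ n) v := by
  induction n with
  | zero => simpa using hv
  | succ n ih =>
    rw [pow_succ', map_mul, Module.End.mul_apply, wt_F ih]
    congr 1; push_cast; ring

theorem EF_apply (hv : V.ρ (gen r .H) v = μ • v) :
    V.ρ (gen r .E) (V.ρ (gen r .F) v) = V.ρ (gen r .F) (V.ρ (gen r .E) v) + qint r μ • v := by
  have hK := V.K_apply μ v hv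
  have hKi : V.ρ (gen r .Kinv) v = qpow r (-μ) • v := by
    have h := LinearMap.congr_fun (congrArg V.ρ (gen_relations r).Kinv_mul_K) v
    rw [map_mul, Module.End.mul_apply, hK, map_smul, map_one, Module.End.one_apply] at h
    nth_rw 2 [← h]
    rw [smul_smul, qpow_neg_mul, one_smul]
  have h := LinearMap.congr_fun (congrArg V.ρ (gen_relations r).EF) v
  simp only [map_sub, map_mul, map_smul, LinearMap.sub_apply, Module.End.mul_apply,
    LinearMap.smul_apply, hK, hKi] at h
  rw [sub_eq_iff_eq_add'.1 h, ← sub_smul, smul_smul, qint, br, br, div_eq_inv_mul]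

theorem E_pow_F_apply (n : ℕ) (hv : V.ρ (gen r .H) v = μ • v) :
    V.ρ (gen r .E ^ (n + 1)) (V.ρ (gen r .F) v) = V.ρ (gen r .F) (V.ρ (gen r .E ^ (n + 1)) v)
      + (qint r (n + 1) * qint r (μ + n)) • V.ρ (gen r .E ^ n) v := by
  induction n with
  | zero =>
    simp [EF_apply hv, qint_one_mul]
  | succ n ih =>
    have h := qint_mul_sub r (n + 1) (μ + n)
    rw [pow_succ', map_mul, Module.End.mul_apply, ih, map_add, EF_apply (wt_E_pow (n + 1) hv),
      map_smul, Module.End.mul_apply, ← Module.End.mul_apply (V.ρ (gen r .E)) (V.ρ (gen r .E ^ n)),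
      ← map_mul, ← pow_succ', add_assoc, ← add_smul]
    congr 2
    push_cast
    rw [show μ + 2 * ((n : ℂ) + 1) = n + 1 + (μ + n) + 1 by ring, ← h, ← add_assoc μ]
    ring

theorem F_pow_E_apply (n : ℕ) (hv : V.ρ (gen r .H) v = μ • v) :
    V.ρ (gen r .F ^ (n + 1)) (V.ρ (gen r .E) v) = V.ρ (gen r .E) (V.ρ (gen r .F ^ (n + 1)) v)
      - (qint r (n + 1) * qint r (μ - n)) • V.ρ (gen r .F ^ n) v := by
  induction n with
  | zero =>
    simp [EF_apply hv, qint_one_mul]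
  | succ n ih =>
    have h := qint_mul_sub r (n + 1) (n - μ)
    rw [pow_succ', map_mul, Module.End.mul_apply, ih, map_sub,
      ← sub_eq_iff_eq_add.2 (EF_apply (wt_F_pow (n + 1) hv)),
      map_smul, Module.End.mul_apply, ← Module.End.mul_apply (V.ρ (gen r .F)) (V.ρ (gen r .F ^ n)),
      ← map_mul, ← pow_succ', sub_sub, ← add_smul]
    congr 2
    push_cast
    rw [← neg_sub (n : ℂ) μ, qint_neg, show μ - 2 * ((n : ℂ) + 1) = -(n + 1 + (n - μ) + 1) by ring,
      qint_neg, ← h, show μ - ((n : ℂ) + 1) = -(n - μ + 1) by ring, qint_neg]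
    ring

end

variable (V : WeightModule r)

theorem qH_zero : V.qH 0 = 1 :=
  V.ext_weight fun μ v hv => by rw [qH_apply 0 hv]; simp [qpow_zero]

theorem qH_mul (s t : ℂ) : V.qH s * V.qH t = V.qH (s + t) :=
  V.ext_weight fun μ v hv => by
    rw [Module.End.mul_apply, qH_apply t hv, map_smul, qH_apply s hv, qH_apply _ hv, smul_smul,
      ← qpow_add]
    congr 2; ring

theorem ρ_K : V.ρ (gen r .K) = V.qH 1 :=
  V.ext_weight fun μ v hv => by rw [qH_apply 1 hv, one_mul, V.K_apply μ v hv]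

theorem ρ_Kinv : V.ρ (gen r .Kinv) = V.qH (-1) := by
  have h : V.ρ (gen r .Kinv) * V.qH 1 = 1 := by
    rw [← ρ_K, ← map_mul, (gen_relations r).Kinv_mul_K, map_one]
  calc _ = V.ρ (gen r .Kinv) * (V.qH 1 * V.qH (-1)) := by
        rw [qH_mul, add_neg_cancel, qH_zero, mul_one]
    _ = _ := by rw [← mul_assoc, h, one_mul]

theorem ρ_Kinv_pow (n : ℕ) : V.ρ (gen r .Kinv ^ n) = V.qH (-n) := by
  induction n with
  | zero => simp [qH_zero]
  | succ n ih => rw [pow_succ, map_mul, ih, ρ_Kinv, qH_mul]; congr 1; push_cast; ring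

theorem E_pow_mul_qH (n : ℕ) (s : ℂ) :
    V.ρ (gen r .E ^ n) * V.qH s = qpow r (-(2 * n * s)) • (V.qH s * V.ρ (gen r .E ^ n)) :=
  V.ext_weight fun μ v hv => by
    rw [Module.End.mul_apply, qH_apply s hv, map_smul, LinearMap.smul_apply, Module.End.mul_apply,
      qH_apply s (wt_E_pow n hv), smul_smul, ← qpow_add]
    congr 2; ring

theorem F_mul_qH (s : ℂ) :
    V.ρ (gen r .F) * V.qH s = qpow r (2 * s) • (V.qH s * V.ρ (gen r .F)) :=
  V.ext_weight fun μ v hv => by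
    rw [Module.End.mul_apply, qH_apply s hv, map_smul, LinearMap.smul_apply, Module.End.mul_apply,
      qH_apply s (wt_F hv), smul_smul, ← qpow_add]
    congr 2; ring

/-- `E^n F^n` preserves the weight. -/
theorem wt_E_pow_F_pow {V : WeightModule r} {μ : ℂ} {v : V.carrier} (n : ℕ)
    (hv : V.ρ (gen r .H) v = μ • v) :
    V.ρ (gen r .H) (V.ρ (gen r .E ^ n) (V.ρ (gen r .F ^ n) v))
      = μ • V.ρ (gen r .E ^ n) (V.ρ (gen r .F ^ n) v) := by
  rw [wt_E_pow n (wt_F_pow n hv), sub_add_cancel]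

theorem wt_F_pow_E_pow {V : WeightModule r} {μ : ℂ} {v : V.carrier} (n : ℕ)
    (hv : V.ρ (gen r .H) v = μ • v) :
    V.ρ (gen r .H) (V.ρ (gen r .F ^ n) (V.ρ (gen r .E ^ n) v))
      = μ • V.ρ (gen r .F ^ n) (V.ρ (gen r .E ^ n) v) := by
  rw [wt_F_pow n (wt_E_pow n hv), add_sub_cancel_right]

/-! ### Weighted traces of `E^n F^n` -/

/-- The sum of `φ ν` over the weights `ν` of `V`, with multiplicity. -/
def wtTrace (φ : ℂ → ℂ) : ℂ := LinearMap.trace ℂ V.carrier (V.wtOp φ)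

/-- The trace of `q ^ (s H) E^n F^n`. -/
def qTrace (n : ℕ) (s : ℂ) : ℂ :=
  LinearMap.trace ℂ V.carrier (V.qH s * V.ρ (gen r .E ^ n * gen r .F ^ n))

theorem qTrace_zero (s : ℂ) : V.qTrace 0 s = V.wtTrace fun ν => qpow r (s * ν) := by
  rw [qTrace, pow_zero, pow_zero, mul_one, map_one, mul_one]; rfl

/-- Cyclicity of the trace relates the traces of `q ^ (s H) E^n F^n` for consecutive `n`. -/
theorem br_mul_qTrace_succ (n : ℕ) (s : ℂ) :
    br r s * V.qTrace (n + 1) s = qpow r s * (qint r (n + 1) / br r 1) *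
      (qpow r (-n) * V.qTrace n (s + 1) - qpow r n * V.qTrace n (s - 1)) := by
  -- Moving `F` past `E^(n+1)` produces `[H - n] E^n F^n`, and `[H - n]` shifts `s` by `±1`.
  have hcomm : V.qH s * (V.ρ (gen r .F) * V.ρ (gen r .E ^ (n + 1) * gen r .F ^ n))
      = V.qH s * V.ρ (gen r .E ^ (n + 1) * gen r .F ^ (n + 1))
        - (qint r (n + 1) / br r 1) •
          (qpow r (-n) • (V.qH (s + 1) * V.ρ (gen r .E ^ n * gen r .F ^ n))
            - qpow r n • (V.qH (s - 1) * V.ρ (gen r .E ^ n * gen r .F ^ n))) := by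
    refine V.ext_weight fun μ v hv => ?_
    have h := E_pow_F_apply n (wt_F_pow n hv)
    have hw := wt_E_pow_F_pow n hv
    simp only [Module.End.mul_apply, LinearMap.sub_apply, LinearMap.smul_apply, map_mul]
    rw [← sub_eq_iff_eq_add.2 h, map_sub, map_smul, qH_apply s hw, qH_apply (s + 1) hw,
      qH_apply (s - 1) hw, ← Module.End.mul_apply (V.ρ (gen r .F)) (V.ρ (gen r .F ^ n)), ← map_mul,
      ← pow_succ']
    congr 1
    simp only [smul_smul, ← sub_smul, ← qpow_add]
    congr 1
    rw [show μ - 2 * (n : ℂ) + n = μ - n by ring, qint, qint, br.eq_1 r (μ - n),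
      show -(n : ℂ) + (s + 1) * μ = s * μ + (μ - n) by ring,
      show (n : ℂ) + (s - 1) * μ = s * μ + -(μ - n) by ring, qpow_add, qpow_add]
    ring
  -- Moving `F` around the trace and past `q ^ (s H)` produces the factor `q ^ (2 s)`.
  have h : V.qTrace (n + 1) s = qpow r (2 * s) * (V.qTrace (n + 1) s
      - (qint r (n + 1) / br r 1) *
        (qpow r (-n) * V.qTrace n (s + 1) - qpow r n * V.qTrace n (s - 1))) := by
    have h1 := congrArg (LinearMap.trace ℂ V.carrier) hcomm
    simp only [map_sub, map_smul, smul_eq_mul] at h1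
    have h2 : V.qTrace (n + 1) s = qpow r (2 * s) * LinearMap.trace ℂ V.carrier
        (V.qH s * (V.ρ (gen r .F) * V.ρ (gen r .E ^ (n + 1) * gen r .F ^ n))) := by
      rw [qTrace, pow_succ (gen r .F), ← mul_assoc (gen r .E ^ (n + 1)), map_mul V.ρ, ← mul_assoc,
        LinearMap.trace_mul_comm, ← mul_assoc, F_mul_qH, smul_mul_assoc, map_smul, smul_eq_mul,
        mul_assoc]
    rw [h1] at h2
    exact h2
  have e : qpow r (2 * s) = qpow r s * qpow r s := by rw [← qpow_add]; congr 1; ring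
  rw [e] at h
  rw [br]
  linear_combination -qpow r (-s) * h - (V.qTrace (n + 1) s * qpow r s -
    qpow r s * (qint r (n + 1) / br r 1 *
      (qpow r (-n) * V.qTrace n (s + 1) - qpow r n * V.qTrace n (s - 1)))) * qpow_neg_mul r s

/-- The trace of `φ(H) A` is a combination of finitely many values of `φ`. This gives the
differentiability in `s` of traces that involve `q ^ (s H)`. -/
theorem exists_trace_wtOp_mul (A : Module.End ℂ V.carrier) :
    ∃ (s : Finset ℂ) (c : ℂ → ℂ), ∀ φ : ℂ → ℂ,
      LinearMap.trace ℂ V.carrier (V.wtOp φ * A) = ∑ ν ∈ s, φ ν * c ν := by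
  refine ⟨(minpoly ℂ (V.ρ (gen r .H))).roots.toFinset, fun ν => LinearMap.trace ℂ V.carrier
    (Polynomial.aeval (V.ρ (gen r .H))
      (Lagrange.basis (minpoly ℂ (V.ρ (gen r .H))).roots.toFinset id ν) * A), fun φ => ?_⟩
  rw [wtOp, diagFun, Lagrange.interpolate_apply, map_sum, Finset.sum_mul, map_sum]
  refine Finset.sum_congr rfl fun ν _ => ?_
  rw [map_mul (Polynomial.aeval _), Polynomial.aeval_C, ← Algebra.smul_def, smul_mul_assoc,
    map_smul, smul_eq_mul]

theorem hasDerivAt_qpow_mul (r : ℕ) (ν s : ℂ) :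
    HasDerivAt (fun s => qpow r (s * ν)) (Real.pi * Complex.I / r * (ν * qpow r (s * ν))) s := by
  have h : HasDerivAt (fun s : ℂ => Real.pi * Complex.I * (s * ν) / r)
      (Real.pi * Complex.I / r * ν) s := by
    have := ((hasDerivAt_id s).const_mul (Real.pi * Complex.I / r * ν))
    rw [mul_one] at this
    refine this.congr_of_eventuallyEq (Filter.Eventually.of_forall fun s => ?_)
    simp only [id]; ring
  exact h.cexp.congr_deriv (by rw [qpow]; ring)

theorem differentiable_qTrace (n : ℕ) : Differentiable ℂ (V.qTrace n) := by
  obtain ⟨s, c, h⟩ := V.exists_trace_wtOp_mul (V.ρ (gen r .E ^ n * gen r .F ^ n))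
  have : V.qTrace n = fun t => ∑ ν ∈ s, qpow r (t * ν) * c ν := funext fun t => h _
  rw [this]
  exact Differentiable.fun_sum fun ν _ t =>
    ((hasDerivAt_qpow_mul r ν t).mul_const (c ν)).differentiableAt

theorem hasDerivAt_qTrace_zero (s : ℂ) :
    HasDerivAt (V.qTrace 0)
      (Real.pi * Complex.I / r * V.wtTrace fun ν => ν * qpow r (s * ν)) s := by
  obtain ⟨S, c, h⟩ := V.exists_trace_wtOp_mul 1
  simp only [mul_one] at h
  have e : V.qTrace 0 = fun t => ∑ ν ∈ S, qpow r (t * ν) * c ν :=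
    funext fun t => (V.qTrace_zero t).trans (h _)
  rw [e, wtTrace, h, Finset.mul_sum]
  refine HasDerivAt.fun_sum fun ν _ => ?_
  exact ((hasDerivAt_qpow_mul r ν s).mul_const (c ν)).congr_deriv (by ring)

end WeightModule

namespace WeightModule

variable {r : ℕ}

/-! ### Open Hopf links on weight vectors -/

/-- The coefficient `({1}^{2n} / {n}!) q ^ (n (n - 1) / 2)` of `E^n ⊗ F^n` in the `R`-matrix. -/
def rCoeff (r n : ℕ) : ℂ :=
  br r 1 ^ (2 * n) / brFact r n * qpow r ((n : ℂ) * ((n : ℂ) - 1) / 2)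

theorem qHH_tmul {V W : WeightModule r} {μ : ℂ} {w : V.carrier}
    (hw : V.ρ (gen r .H) w = μ • w) (z : W.carrier) :
    qHH V W (w ⊗ₜ z) = w ⊗ₜ W.qH (μ / 2) z := by
  have h : qHH V W ∘ₗ TensorProduct.mk ℂ _ _ w = TensorProduct.mk ℂ _ _ w ∘ₗ W.qH (μ / 2) := by
    refine W.ext_weight fun ν z hz => ?_
    have h1 : TensorProduct.map (V.ρ (gen r .H)) (W.ρ (gen r .H)) (w ⊗ₜ z)
        = (μ * ν) • (w ⊗ₜ[ℂ] z) := by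
      rw [TensorProduct.map_tmul, hw, hz, TensorProduct.smul_tmul_smul]
    rw [LinearMap.comp_apply, LinearMap.comp_apply, TensorProduct.mk_apply, TensorProduct.mk_apply,
      qHH, diagFun_apply _ _ h1, qH_apply _ hz, TensorProduct.tmul_smul]
    congr 2; ring
  exact LinearMap.congr_fun h z

theorem qHH_tmul' {V W : WeightModule r} {μ : ℂ} {w : W.carrier}
    (hw : W.ρ (gen r .H) w = μ • w) (z : V.carrier) :
    qHH V W (z ⊗ₜ w) = V.qH (μ / 2) z ⊗ₜ w := by
  have h : qHH V W ∘ₗ (TensorProduct.mk ℂ _ _).flip w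
      = (TensorProduct.mk ℂ _ _).flip w ∘ₗ V.qH (μ / 2) := by
    refine V.ext_weight fun ν z hz => ?_
    have h1 : TensorProduct.map (V.ρ (gen r .H)) (W.ρ (gen r .H)) (z ⊗ₜ w)
        = (ν * μ) • (z ⊗ₜ[ℂ] w) := by
      rw [TensorProduct.map_tmul, hw, hz, TensorProduct.smul_tmul_smul]
    rw [LinearMap.comp_apply, LinearMap.comp_apply, LinearMap.flip_apply, LinearMap.flip_apply,
      TensorProduct.mk_apply, TensorProduct.mk_apply,
      qHH, diagFun_apply _ _ h1, qH_apply _ hz, ← TensorProduct.smul_tmul']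
    congr 2; ring
  exact LinearMap.congr_fun h z

theorem braiding_tmul {V W : WeightModule r} {μ : ℂ} {w : V.carrier}
    (hw : V.ρ (gen r .H) w = μ • w) (z : W.carrier) :
    braiding V W (w ⊗ₜ z) = ∑ n ∈ Finset.range r,
      rCoeff r n • (W.qH (μ / 2 + n) (W.ρ (gen r .F ^ n) z) ⊗ₜ V.ρ (gen r .E ^ n) w) := by
  rw [braiding, LinearMap.comp_apply, rMatrix, Module.End.mul_apply, LinearMap.sum_apply, map_sum,
    map_sum]
  refine Finset.sum_congr rfl fun n _ => ?_
  rw [LinearMap.smul_apply, TensorProduct.map_tmul, map_smul, qHH_tmul (wt_E_pow n hw), map_smul,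
    LinearEquiv.coe_coe, TensorProduct.comm_tmul, rCoeff]
  congr 4; ring

theorem braiding_tmul' {V W : WeightModule r} {μ : ℂ} {w : W.carrier}
    (hw : W.ρ (gen r .H) w = μ • w) (z : V.carrier) :
    braiding V W (z ⊗ₜ w) = ∑ n ∈ Finset.range r,
      rCoeff r n • (W.ρ (gen r .F ^ n) w ⊗ₜ V.qH (μ / 2 - n) (V.ρ (gen r .E ^ n) z)) := by
  rw [braiding, LinearMap.comp_apply, rMatrix, Module.End.mul_apply, LinearMap.sum_apply, map_sum,
    map_sum]
  refine Finset.sum_congr rfl fun n _ => ?_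
  rw [LinearMap.smul_apply, TensorProduct.map_tmul, map_smul, qHH_tmul' (wt_F_pow n hw), map_smul,
    LinearEquiv.coe_coe, TensorProduct.comm_tmul, rCoeff]
  congr 4; ring

/-- The open Hopf link is a partial trace of the double braiding. -/
theorem hopf_apply_of_double_braiding {V W : WeightModule r} {ι : Type*} (s : Finset ι)
    (w : W.carrier) (x : ι → W.carrier) (g : ι → Module.End ℂ V.carrier)
    (h : ∀ z : V.carrier, braiding V W (braiding W V (w ⊗ₜ z)) = ∑ i ∈ s, x i ⊗ₜ g i z) :
    hopf V W w = ∑ i ∈ s,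
      LinearMap.trace ℂ V.carrier (V.ρ (gen r .Kinv ^ (r - 1)) * g i) • x i := by
  classical
  have e : hopf V W w = ∑ a, ∑ i ∈ s,
      (Module.Basis.ofVectorSpace ℂ V.carrier).coord a
        (V.ρ (gen r .Kinv ^ (r - 1)) (g i (Module.Basis.ofVectorSpace ℂ V.carrier a))) • x i := by
    simp only [hopf, coev, LinearMap.comp_apply, LinearEquiv.coe_coe, TensorProduct.rid_symm_apply,
      LinearMap.lTensor_tmul, coevaluation_apply_one, TensorProduct.tmul_sum, map_sum,
      TensorProduct.assoc_symm_tmul, LinearMap.rTensor_tmul, h, TensorProduct.sum_tmul,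
      TensorProduct.assoc_tmul, ev'_tmul, TensorProduct.rid_tmul]
  rw [e, Finset.sum_comm]
  refine Finset.sum_congr rfl fun i _ => ?_
  rw [← Finset.sum_smul, LinearMap.trace_eq_matrix_trace ℂ (Module.Basis.ofVectorSpace ℂ V.carrier)]
  congr 1
  refine Finset.sum_congr rfl fun a _ => ?_
  rw [Matrix.diag_apply, LinearMap.toMatrix_apply, Module.End.mul_apply, Module.Basis.coord_apply]

/-- An operator that changes the weight has trace zero. -/
theorem trace_eq_zero_of_commutator (V : WeightModule r) {c : ℂ} (hc : c ≠ 0)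
    {X : Module.End ℂ V.carrier} (hX : V.ρ (gen r .H) * X = X * V.ρ (gen r .H) + c • X) :
    LinearMap.trace ℂ V.carrier X = 0 := by
  have h := congrArg (LinearMap.trace ℂ V.carrier) hX
  rw [map_add, LinearMap.trace_mul_comm, map_smul, left_eq_add, smul_eq_mul] at h
  exact (mul_eq_zero.1 h).resolve_left hc

/-- The coefficient of `F^n E^n` in the action of the open Hopf link with colour `V` on vectors of
weight `μ`. -/
def hopfCoeff (V : WeightModule r) (n : ℕ) (μ : ℂ) : ℂ :=
  rCoeff r n ^ 2 * qpow r (-(n * (μ + 2 * n))) * V.qTrace n (μ + n + 1 - r)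

theorem hopf_apply {V W : WeightModule r} (hr : r ≠ 0) {μ : ℂ} {w : W.carrier}
    (hw : W.ρ (gen r .H) w = μ • w) :
    hopf V W w = ∑ n ∈ Finset.range r,
      V.hopfCoeff n μ • W.ρ (gen r .F ^ n) (W.ρ (gen r .E ^ n) w) := by
  have h : ∀ z : V.carrier, braiding V W (braiding W V (w ⊗ₜ z))
      = ∑ p ∈ Finset.range r ×ˢ Finset.range r,
        ((rCoeff r p.1 * rCoeff r p.2) • W.ρ (gen r .F ^ p.2) (W.ρ (gen r .E ^ p.1) w)) ⊗ₜ[ℂ]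
          (V.qH (μ / 2 + p.1 - p.2) * V.ρ (gen r .E ^ p.2) * V.qH (μ / 2 + p.1)
            * V.ρ (gen r .F ^ p.1)) z := by
    intro z
    rw [braiding_tmul hw, map_sum, Finset.sum_product]
    refine Finset.sum_congr rfl fun n _ => ?_
    rw [map_smul, braiding_tmul' (wt_E_pow n hw), Finset.smul_sum]
    refine Finset.sum_congr rfl fun m _ => ?_
    rw [smul_smul, TensorProduct.smul_tmul', show (μ + 2 * (n : ℂ)) / 2 - m = μ / 2 + n - m by ring]
    rfl
  rw [hopf_apply_of_double_braiding _ w _ _ h, Finset.sum_product]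
  refine Finset.sum_congr rfl fun n hn => ?_
  -- Only `m = n` contributes to the trace; the operators with `m ≠ n` shift the weight.
  rw [Finset.sum_eq_single n]
  · have hop : V.ρ (gen r .Kinv ^ (r - 1)) * (V.qH (μ / 2 + n - n) * V.ρ (gen r .E ^ n)
        * V.qH (μ / 2 + n) * V.ρ (gen r .F ^ n))
        = qpow r (-(n * (μ + 2 * n))) •
          (V.qH (μ + n + 1 - r) * V.ρ (gen r .E ^ n * gen r .F ^ n)) := by
      rw [mul_assoc (V.qH _), E_pow_mul_qH, mul_smul_comm, smul_mul_assoc, mul_smul_comm,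
        ρ_Kinv_pow, map_mul]
      simp only [← mul_assoc, qH_mul]
      rw [Nat.cast_sub (Nat.one_le_iff_ne_zero.2 hr)]
      congr 2
      · congr 1; ring
      · congr 2; push_cast; ring
    rw [hop, map_smul, smul_smul, hopfCoeff, qTrace, smul_eq_mul]
    congr 1; ring
  · intro m _ hmn
    have hne : (2 * ((m : ℂ) - n)) ≠ 0 :=
      mul_ne_zero two_ne_zero (sub_ne_zero.2 (by exact_mod_cast hmn))
    rw [trace_eq_zero_of_commutator V hne, zero_smul]
    refine V.ext_weight fun ν v hv => ?_
    simp only [ρ_Kinv_pow, Module.End.mul_apply, LinearMap.add_apply, LinearMap.smul_apply, hv,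
      map_smul, qH_apply _ (wt_F_pow n hv), qH_apply _ (wt_E_pow m (wt_F_pow n hv)),
      wt_E_pow m (wt_F_pow n hv), smul_smul, ← add_smul]
    congr 1; ring
  · exact fun h => absurd hn h

/-! ### Centrality of the open Hopf link -/

theorem rCoeff_succ (r n : ℕ) :
    rCoeff r (n + 1) = rCoeff r n * (br r 1 ^ 2 / br r (n + 1) * qpow r n) := by
  have h : ((n + 1 : ℕ) : ℂ) * (((n + 1 : ℕ) : ℂ) - 1) / 2 = n * (n - 1) / 2 + n := by
    push_cast; ring
  rw [rCoeff, rCoeff, h, qpow_add, brFact, brFact, Finset.prod_range_succ]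
  rw [mul_add, pow_add, mul_one]
  simp only [div_eq_mul_inv, mul_inv]
  ring

/-- The relation between consecutive coefficients that makes the open Hopf link commute with the
action of `E` and `F`. -/
theorem hopfCoeff_sub (V : WeightModule r) {n : ℕ} (hn : n + 1 < r) (μ : ℂ) :
    V.hopfCoeff n μ - V.hopfCoeff n (μ - 2)
      = V.hopfCoeff (n + 1) (μ - 2) * (qint r (n + 1) * qint r (μ + n)) := by
  have : NeZero r := ⟨by omega⟩
  have h1 : br r 1 ≠ 0 := br_one_ne_zero (by omega)
  have hn1 : br r ((n : ℂ) + 1) ≠ 0 := by exact_mod_cast br_ne_zero (Nat.succ_pos n) hn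
  have key := V.br_mul_qTrace_succ n (μ + n - r)
  have e1 : br r (μ + n - r) = -br r (μ + n) := by
    have := br_add_int_mul_r r (μ + n) (-1)
    simpa [sub_eq_add_neg] using this
  have e2 : qpow r (μ + n - r) = -(qpow r μ * qpow r n) := by
    rw [sub_eq_add_neg, qpow_add, qpow_add, qpow_neg r r, qpow_r r (NeZero.ne r)]
    norm_num
  rw [e1, e2] at key
  have e3 : qpow r (-((n : ℂ) * (μ - 2 + 2 * n)))
      = qpow r (-((n : ℂ) * (μ + 2 * n))) * qpow r n * qpow r n := by
    rw [← qpow_add, ← qpow_add]; congr 1; ring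
  have e4 : qpow r (-(((n + 1 : ℕ) : ℂ) * (μ - 2 + 2 * (n + 1 : ℕ))))
      = qpow r (-((n : ℂ) * (μ + 2 * n))) * ((qpow r μ)⁻¹ * (qpow r n)⁻¹ * (qpow r n)⁻¹) := by
    rw [← qpow_neg, ← qpow_neg, ← qpow_add, ← qpow_add, ← qpow_add]; congr 1; push_cast; ring
  rw [hopfCoeff, hopfCoeff, hopfCoeff, rCoeff_succ, e3, e4,
    show μ - 2 + (n : ℂ) + 1 - r = μ + n - r - 1 by ring,
    show μ + (n : ℂ) + 1 - r = μ + n - r + 1 by ring,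
    show μ - 2 + ((n + 1 : ℕ) : ℂ) + 1 - r = μ + n - r by push_cast; ring]
  rw [qpow_neg, qint] at key
  rw [qint, qint]
  have hq := qpow_ne_zero r n
  have hm := qpow_ne_zero r μ
  generalize qpow r (-((n : ℂ) * (μ + 2 * n))) = A
  field_simp at key ⊢
  linear_combination rCoeff r n ^ 2 * A * key

theorem hopf_F {V W : WeightModule r} (hr : r ≠ 0) {μ : ℂ} {w : W.carrier}
    (hw : W.ρ (gen r .H) w = μ • w) :
    hopf V W (W.ρ (gen r .F) w) = W.ρ (gen r .F) (hopf V W w) := by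
  obtain ⟨R, rfl⟩ : ∃ R, r = R + 1 := ⟨r - 1, by omega⟩
  have hlast : ∀ u : W.carrier, W.ρ (gen (R + 1) .F ^ (R + 1)) u = 0 := fun u => by
    rw [(gen_relations (R + 1)).F_pow, map_zero, LinearMap.zero_apply]
  have hFF : ∀ (n : ℕ) (u : W.carrier), W.ρ (gen (R + 1) .F ^ n) (W.ρ (gen (R + 1) .F) u)
      = W.ρ (gen (R + 1) .F ^ (n + 1)) u := fun n u => by
    rw [pow_succ, map_mul, Module.End.mul_apply]
  have hFF' : ∀ (n : ℕ) (u : W.carrier), W.ρ (gen (R + 1) .F) (W.ρ (gen (R + 1) .F ^ n) u)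
      = W.ρ (gen (R + 1) .F ^ (n + 1)) u := fun n u => by
    rw [pow_succ', map_mul, Module.End.mul_apply]
  rw [hopf_apply hr hw, hopf_apply hr (wt_F hw), map_sum,
    Finset.sum_range_succ' _ R, Finset.sum_range_succ _ R]
  simp only [E_pow_F_apply _ hw, map_add, map_smul, hFF, hFF', hlast, smul_zero, add_zero,
    pow_zero, map_one, Module.End.one_apply, smul_add, smul_smul, Finset.sum_add_distrib]
  -- `hopfCoeff_sub` is not available for `n = R`, but there `F^(R+1) = 0`.
  have h1 : ∑ n ∈ Finset.range R, V.hopfCoeff n μ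
        • W.ρ (gen (R + 1) .F ^ (n + 1)) (W.ρ (gen (R + 1) .E ^ n) w)
      = ∑ n ∈ Finset.range R, V.hopfCoeff n (μ - 2)
        • W.ρ (gen (R + 1) .F ^ (n + 1)) (W.ρ (gen (R + 1) .E ^ n) w)
      + ∑ n ∈ Finset.range R,
        (V.hopfCoeff (n + 1) (μ - 2) * (qint (R + 1) (n + 1) * qint (R + 1) (μ + n)))
        • W.ρ (gen (R + 1) .F ^ (n + 1)) (W.ρ (gen (R + 1) .E ^ n) w) := by
    rw [← Finset.sum_add_distrib]
    refine Finset.sum_congr rfl fun n hn => ?_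
    rw [← add_smul, ← V.hopfCoeff_sub (by have := Finset.mem_range.1 hn; omega) μ,
      add_sub_cancel]
  have h2 := Finset.sum_range_succ' (fun n => V.hopfCoeff n (μ - 2)
        • W.ρ (gen (R + 1) .F ^ (n + 1)) (W.ρ (gen (R + 1) .E ^ n) w)) R
  rw [Finset.sum_range_succ, hlast, smul_zero, add_zero] at h2
  rw [h1, h2]
  simp only [pow_zero, map_one, Module.End.one_apply, zero_add, pow_one]
  abel

theorem hopf_E {V W : WeightModule r} (hr : r ≠ 0) {μ : ℂ} {w : W.carrier}
    (hw : W.ρ (gen r .H) w = μ • w) :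
    hopf V W (W.ρ (gen r .E) w) = W.ρ (gen r .E) (hopf V W w) := by
  obtain ⟨R, rfl⟩ : ∃ R, r = R + 1 := ⟨r - 1, by omega⟩
  have hlast : ∀ u : W.carrier, W.ρ (gen (R + 1) .E ^ (R + 1)) u = 0 := fun u => by
    rw [(gen_relations (R + 1)).E_pow, map_zero, LinearMap.zero_apply]
  have hEE : ∀ (n : ℕ) (u : W.carrier), W.ρ (gen (R + 1) .E ^ n) (W.ρ (gen (R + 1) .E) u)
      = W.ρ (gen (R + 1) .E ^ (n + 1)) u := fun n u => by
    rw [pow_succ, map_mul, Module.End.mul_apply]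
  have hEE' : ∀ (n : ℕ) (u : W.carrier), W.ρ (gen (R + 1) .E) (W.ρ (gen (R + 1) .E ^ n) u)
      = W.ρ (gen (R + 1) .E ^ (n + 1)) u := fun n u => by
    rw [pow_succ', map_mul, Module.End.mul_apply]
  have hEF : ∀ n : ℕ, W.ρ (gen (R + 1) .E) (W.ρ (gen (R + 1) .F ^ (n + 1))
        (W.ρ (gen (R + 1) .E ^ (n + 1)) w))
      = W.ρ (gen (R + 1) .F ^ (n + 1)) (W.ρ (gen (R + 1) .E ^ (n + 1 + 1)) w)
      + (qint (R + 1) (n + 1) * qint (R + 1) (μ + 2 + n))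
        • W.ρ (gen (R + 1) .F ^ n) (W.ρ (gen (R + 1) .E ^ (n + 1)) w) := fun n => by
    rw [sub_eq_iff_eq_add.1 (F_pow_E_apply n (wt_E_pow (n + 1) hw)).symm, hEE']
    congr 4; push_cast; ring
  rw [hopf_apply hr hw, hopf_apply hr (wt_E hw), map_sum,
    Finset.sum_range_succ _ R, Finset.sum_range_succ' _ R]
  simp only [hEF, map_smul, hEE, hlast, smul_zero, add_zero, map_zero,
    pow_zero, map_one, Module.End.one_apply, smul_add, smul_smul, Finset.sum_add_distrib]
  -- `hopfCoeff_sub` is not available for `n = R`, but there `E^(R+1) = 0`.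
  have h1 : ∑ n ∈ Finset.range R, V.hopfCoeff n (μ + 2)
        • W.ρ (gen (R + 1) .F ^ n) (W.ρ (gen (R + 1) .E ^ (n + 1)) w)
      = ∑ n ∈ Finset.range R, V.hopfCoeff n μ
        • W.ρ (gen (R + 1) .F ^ n) (W.ρ (gen (R + 1) .E ^ (n + 1)) w)
      + ∑ n ∈ Finset.range R,
        (V.hopfCoeff (n + 1) μ * (qint (R + 1) (n + 1) * qint (R + 1) (μ + 2 + n)))
        • W.ρ (gen (R + 1) .F ^ n) (W.ρ (gen (R + 1) .E ^ (n + 1)) w) := by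
    rw [← Finset.sum_add_distrib]
    refine Finset.sum_congr rfl fun n hn => ?_
    have h := V.hopfCoeff_sub (r := R + 1) (n := n)
      (by have := Finset.mem_range.1 hn; omega) (μ + 2)
    rw [add_sub_cancel_right] at h
    rw [← add_smul, ← h, add_sub_cancel]
  have h2 := Finset.sum_range_succ' (fun n => V.hopfCoeff n μ
        • W.ρ (gen (R + 1) .F ^ n) (W.ρ (gen (R + 1) .E ^ (n + 1)) w)) R
  rw [Finset.sum_range_succ, hlast, map_zero, smul_zero, add_zero] at h2
  rw [h1, h2]
  simp only [pow_zero, map_one, Module.End.one_apply, zero_add, pow_one]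
  abel

theorem wt_hopf {V W : WeightModule r} (hr : r ≠ 0) {μ : ℂ} {w : W.carrier}
    (hw : W.ρ (gen r .H) w = μ • w) :
    W.ρ (gen r .H) (hopf V W w) = μ • hopf V W w := by
  rw [hopf_apply hr hw, map_sum, Finset.smul_sum]
  refine Finset.sum_congr rfl fun n _ => ?_
  rw [map_smul, wt_F_pow_E_pow n hw, smul_comm]

/-- The open Hopf link as an endomorphism of the module `W`. -/
def hopfHom (hr : r ≠ 0) (V W : WeightModule r) : Hom W W :=
  Hom.ofGen (hopf V W) (by
    intro g
    refine W.ext_weight fun μ w hw => ?_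
    rw [LinearMap.comp_apply, LinearMap.comp_apply]
    cases g
    · exact hopf_E hr hw
    · exact hopf_F hr hw
    · rw [ρ_K, qH_apply 1 hw, qH_apply 1 (wt_hopf hr hw), map_smul]
    · rw [ρ_Kinv, qH_apply (-1) hw, qH_apply (-1) (wt_hopf hr hw), map_smul]
    · rw [hw, wt_hopf hr hw, map_smul])

end WeightModule

/-! ### The open Hopf link on `P_j ⊗ ℂ^H_{lr}` -/

theorem qint_mul_sub_mul (r : ℕ) (a b c : ℂ) :
    qint r a * qint r b - qint r (a - c) * qint r (b + c) = qint r c * qint r (b - a + c) := by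
  simp only [qint, br, sub_eq_add_neg, neg_add, qpow_add, neg_neg]
  have ha := qpow_mul_neg r a
  have hb := qpow_mul_neg r b
  have hc := qpow_mul_neg r c
  generalize qpow r a = A at *
  generalize qpow r (-a) = A' at *
  generalize qpow r b = B at *
  generalize qpow r (-b) = B' at *
  generalize qpow r c = C at *
  generalize qpow r (-c) = C' at *
  generalize qpow r 1 = q at *
  generalize qpow r (-1) = q' at *
  rcases eq_or_ne (q - q') 0 with h0 | h0
  · simp [← sub_eq_add_neg, h0]
  · have h0' : q + -q' ≠ 0 := by rwa [← sub_eq_add_neg]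
    field_simp
    linear_combination (A * B' + A' * B - A * B - A' * B') * hc

namespace WeightModule

theorem hopfCoeff_zero {r : ℕ} (V : WeightModule r) (μ : ℂ) :
    V.hopfCoeff 0 μ = V.qTrace 0 (μ + 1 - r) := by
  simp [hopfCoeff, rCoeff, brFact, qpow_zero]

/-- The open Hopf link takes the same scalar value on a highest weight vector of weight `μ + 2 m`
and on its `m`-th descendant, of weight `μ`; the product is the action of `F^n E^n` on that
descendant. -/
theorem sum_hopfCoeff_mul_prod {r : ℕ} (V : WeightModule r) (m : ℕ) (hm : m < r) (μ : ℂ) :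
    ∑ n ∈ Finset.range (m + 1), V.hopfCoeff n μ *
        ∏ k ∈ Finset.range n, qint r (m - k) * qint r (μ + m + 1 + k)
      = V.hopfCoeff 0 (μ + 2 * m) := by
  induction m generalizing μ with
  | zero => simp
  | succ m ih =>
    rw [show μ + 2 * ((m + 1 : ℕ) : ℂ) = μ + 2 + 2 * m by push_cast; ring, ← ih (by omega) (μ + 2)]
    have hp : ∀ n : ℕ, ∏ k ∈ Finset.range (n + 1),
        qint r ((m + 1 : ℕ) - (k : ℂ)) * qint r (μ + (m + 1 : ℕ) + 1 + k)
        = ∏ k ∈ Finset.range (n + 1), qint r (m - k) * qint r (μ + 2 + m + 1 + k)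
        + qint r (n + 1) * qint r (μ + 2 + n) *
          ∏ k ∈ Finset.range n, qint r (m - k) * qint r (μ + 2 + m + 1 + k) := by
      intro n
      have hX : ∏ k ∈ Finset.range n, qint r ((m + 1 : ℕ) - ((k + 1 : ℕ) : ℂ))
            * qint r (μ + (m + 1 : ℕ) + 1 + (k + 1 : ℕ))
          = ∏ k ∈ Finset.range n, qint r (m - k) * qint r (μ + 2 + m + 1 + k) := by
        refine Finset.prod_congr rfl fun k _ => ?_
        congr 2 <;> push_cast <;> ring
      have h := qint_mul_sub_mul r (m + 1) (μ + m + 2) (n + 1)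
      rw [Finset.prod_range_succ', hX, Finset.prod_range_succ]
      rw [show (m : ℂ) + 1 - (n + 1) = m - n by ring,
        show μ + m + 2 + ((n : ℂ) + 1) = μ + 2 + m + 1 + n by ring,
        show μ + m + 2 - ((m : ℂ) + 1) + (n + 1) = μ + 2 + n by ring] at h
      rw [show ((m + 1 : ℕ) : ℂ) - (0 : ℕ) = m + 1 by push_cast; ring,
        show μ + ((m + 1 : ℕ) : ℂ) + 1 + (0 : ℕ) = μ + m + 2 by push_cast; ring]
      linear_combination (∏ k ∈ Finset.range n, qint r (m - k) * qint r (μ + 2 + m + 1 + k)) * h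
    have hlast : ∏ k ∈ Finset.range (m + 1), qint r (m - k) * qint r (μ + 2 + m + 1 + k) = 0 := by
      rw [Finset.prod_range_succ, sub_self, qint_zero, zero_mul, mul_zero]
    have hsplit : ∑ n ∈ Finset.range (m + 1), V.hopfCoeff n (μ + 2) *
          ∏ k ∈ Finset.range n, qint r (m - k) * qint r (μ + 2 + m + 1 + k)
        = ∑ n ∈ Finset.range (m + 1), V.hopfCoeff n μ *
          ∏ k ∈ Finset.range n, qint r (m - k) * qint r (μ + 2 + m + 1 + k)
        + ∑ n ∈ Finset.range (m + 1), V.hopfCoeff (n + 1) μ *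
          (qint r (n + 1) * qint r (μ + 2 + n) *
          ∏ k ∈ Finset.range n, qint r (m - k) * qint r (μ + 2 + m + 1 + k)) := by
      rw [← Finset.sum_add_distrib]
      refine Finset.sum_congr rfl fun n hn => ?_
      have h := V.hopfCoeff_sub (n := n) (by have := Finset.mem_range.1 hn; omega) (μ + 2)
      rw [add_sub_cancel_right] at h
      linear_combination (∏ k ∈ Finset.range n, qint r (m - k) * qint r (μ + 2 + m + 1 + k)) * h
    have hshift := Finset.sum_range_succ' (fun n => V.hopfCoeff n μ *
          ∏ k ∈ Finset.range n, qint r (m - k) * qint r (μ + 2 + m + 1 + k)) (m + 1)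
    rw [Finset.sum_range_succ, hlast, mul_zero, add_zero] at hshift
    rw [hsplit, hshift, Finset.sum_range_succ' _ (m + 1)]
    simp only [hp, mul_add, Finset.sum_add_distrib, Finset.prod_range_zero]
    ring

theorem hasDerivAt_qint (r : ℕ) (z : ℂ) :
    HasDerivAt (qint r) (Real.pi * Complex.I / r * (qpow r z + qpow r (-z)) / br r 1) z := by
  have h1 := hasDerivAt_qpow_mul r 1 z
  have h2 := hasDerivAt_qpow_mul r (-1) z
  have h := (h1.sub h2).div_const (br r 1)
  simp only [mul_one, mul_neg] at h
  exact h.congr_deriv (by ring)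

theorem differentiable_qpow (r : ℕ) : Differentiable ℂ (qpow r) := by
  unfold qpow; fun_prop

theorem differentiable_qint (r : ℕ) : Differentiable ℂ (qint r) :=
  fun z => (hasDerivAt_qint r z).differentiableAt

theorem differentiable_hopfCoeff {r : ℕ} (V : WeightModule r) (n : ℕ) :
    Differentiable ℂ (V.hopfCoeff n) := by
  have h1 := V.differentiable_qTrace n
  have h2 := differentiable_qpow r
  unfold hopfCoeff
  fun_prop

/-- The coefficient of the nilpotent part of the open Hopf link. For generic `μ` the two highest
weights `μ` and `μ + 2 (r - 1 - j)` give different scalars; their difference vanishes at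
`μ = j + l r`, and its derivative there is a multiple of the sum on the left. On the right are the
derivatives of the two scalars. -/
theorem sum_hopfCoeff_nilpotent {r : ℕ} (V : WeightModule r) {j : ℕ} (hj : j + 2 ≤ r) (l : ℤ) :
    ∑ n ∈ Finset.range (r - 1 - j), V.hopfCoeff (n + 1) (j + l * r) * ((-1) ^ l) ^ (n + 1) *
        ∏ k ∈ Finset.range n, -(qint r (1 + j + (k + 1 : ℕ)) * qint r (k + 1 : ℕ))
      = br r 1 / (2 * qint r (j + 1)) *
        ((V.wtTrace fun ν => ν * qpow r ((j + 1 + (l - 1) * r) * ν))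
          - V.wtTrace fun ν => ν * qpow r ((-(j + 1) + (l + 1) * r) * ν)) := by
  have : NeZero r := ⟨by omega⟩
  obtain ⟨m, hm⟩ : ∃ m, m = r - 1 - j := ⟨_, rfl⟩
  have hmr : (r : ℂ) = m + 1 + j := by
    have : r = m + 1 + j := by omega
    exact_mod_cast this
  have hm0 : m < r := by omega
  rw [← hm]
  have h1 : br r 1 ≠ 0 := br_one_ne_zero (by omega)
  have hj1 : qint r ((j : ℂ) + 1) ≠ 0 := by
    exact_mod_cast qint_ne_zero (r := r) (Nat.succ_pos j) (by omega)
  have hsq : ((-1 : ℂ) ^ l) * (-1) ^ l = 1 := by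
    rw [← mul_zpow]; norm_num
  set μ₀ : ℂ := j + l * r with hμ₀
  -- The quotient of the difference of the two scalars by `[m] [μ + m + 1]`.
  let g : ℂ → ℂ := fun μ => ∑ n ∈ Finset.range m, V.hopfCoeff (n + 1) μ *
    ∏ k ∈ Finset.range n, qint r (m - (k + 1 : ℕ)) * qint r (μ + m + 1 + (k + 1 : ℕ))
  have hid : ∀ μ, V.qTrace 0 (μ + (2 * m + 1 - r)) - V.qTrace 0 (μ + (1 - r))
      = qint r m * (qint r (μ + (m + 1)) * g μ) := by
    intro μ
    have h := V.sum_hopfCoeff_mul_prod m hm0 μ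
    rw [Finset.sum_range_succ', hopfCoeff_zero, hopfCoeff_zero] at h
    simp only [Finset.prod_range_succ' _ (_ : ℕ), Finset.prod_range_zero, mul_one, Nat.cast_zero,
      sub_zero, add_zero] at h
    rw [show μ + (2 * (m : ℂ) + 1 - r) = μ + 2 * m + 1 - r by ring, ← h,
      show μ + (1 - (r : ℂ)) = μ + 1 - r by ring, add_sub_cancel_right, Finset.mul_sum,
      Finset.mul_sum]
    refine Finset.sum_congr rfl fun n _ => ?_
    rw [← add_assoc μ]
    ring
  have hg : DifferentiableAt ℂ g μ₀ := by
    have := fun n => V.differentiable_hopfCoeff n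
    have := differentiable_qint r
    fun_prop
  have hd1 : HasDerivAt (fun μ => V.qTrace 0 (μ + (2 * m + 1 - r)) - V.qTrace 0 (μ + (1 - r)))
      (Real.pi * Complex.I / r * (V.wtTrace fun ν => ν * qpow r ((μ₀ + (2 * m + 1 - r)) * ν))
        - Real.pi * Complex.I / r * (V.wtTrace fun ν => ν * qpow r ((μ₀ + (1 - r)) * ν))) μ₀ :=
    ((V.hasDerivAt_qTrace_zero _).comp_add_const _ _).sub
      ((V.hasDerivAt_qTrace_zero _).comp_add_const _ _)
  have hz : μ₀ + ((m : ℂ) + 1) = ((l + 1 : ℤ) : ℂ) * r := by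
    rw [hμ₀]; push_cast; rw [hmr]; ring
  have hq0 : qint r (μ₀ + (m + 1)) = 0 := by rw [hz, qint_int_r]
  have hq : qpow r (μ₀ + (m + 1)) = -(-1) ^ l := by
    rw [hz, qpow_int_r r (NeZero.ne r), zpow_add₀ (by norm_num)]; simp
  have hq' : qpow r (-(μ₀ + (m + 1))) = -(-1) ^ l := by
    rw [qpow_neg, hq]
    exact inv_eq_of_mul_eq_one_left (by linear_combination hsq)
  -- As `[μ + m + 1]` vanishes at `μ₀`, only its own derivative contributes.
  have hd2 := (((hasDerivAt_qint r (μ₀ + (m + 1))).comp_add_const μ₀ ((m : ℂ) + 1)).mul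
    hg.hasDerivAt).const_mul (qint r m)
  rw [hq0, zero_mul, add_zero, hq, hq'] at hd2
  have hder := (hd1.congr_of_eventuallyEq
    (Filter.Eventually.of_forall fun μ => (hid μ).symm)).unique hd2
  have hpi : (Real.pi * Complex.I / r : ℂ) ≠ 0 :=
    div_ne_zero (mul_ne_zero (by exact_mod_cast Real.pi_ne_zero) Complex.I_ne_zero)
      (by exact_mod_cast NeZero.ne r)
  have hxm : qint r m = qint r (j + 1) := by
    have h := qint_add_r r (-(j + 1))
    rw [qint_neg, neg_neg] at h
    rw [← h, hmr]; congr 1; ring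
  -- The structure constants of `P_j ⊗ ℂ^H_{lr}` agree up to signs with the factors in `g μ₀`.
  have hsum : ∑ n ∈ Finset.range m, V.hopfCoeff (n + 1) μ₀ * ((-1) ^ l) ^ (n + 1) *
      ∏ k ∈ Finset.range n, -(qint r (1 + j + (k + 1 : ℕ)) * qint r (k + 1 : ℕ))
      = (-1) ^ l * g μ₀ := by
    rw [Finset.mul_sum]
    refine Finset.sum_congr rfl fun n _ => ?_
    have hp : ∏ k ∈ Finset.range n, qint r (m - (k + 1 : ℕ)) * qint r (μ₀ + m + 1 + (k + 1 : ℕ))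
        = ∏ k ∈ Finset.range n, (-1) ^ l *
          -(qint r (1 + j + (k + 1 : ℕ)) * qint r (k + 1 : ℕ)) := by
      refine Finset.prod_congr rfl fun k _ => ?_
      have e1 : qint r (m - (k + 1 : ℕ)) = qint r (1 + j + (k + 1 : ℕ)) := by
        have h := qint_add_r r (-(1 + j + (k + 1 : ℕ)))
        rw [qint_neg, neg_neg] at h
        rw [← h, hmr]; congr 1; ring
      have e2 : qint r (μ₀ + m + 1 + (k + 1 : ℕ)) = -(-1) ^ l * qint r (k + 1 : ℕ) := by
        have h := qint_add_int_mul_r r (k + 1 : ℕ) (l + 1)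
        rw [zpow_add₀ (by norm_num), ← hz] at h
        rw [show μ₀ + m + 1 + ((k + 1 : ℕ) : ℂ) = (k + 1 : ℕ) + (μ₀ + (m + 1)) by ring, h]
        simp
      rw [e1, e2]; ring
    rw [hp, Finset.prod_mul_distrib, Finset.prod_const, Finset.card_range, pow_succ]
    ring
  rw [hsum]
  have ex : μ₀ + (1 - r) = j + 1 + (l - 1) * r := by rw [hμ₀]; ring
  have ey : μ₀ + (2 * m + 1 - r) = -(j + 1) + (l + 1) * r := by rw [hμ₀, hmr]; ring
  rw [ex, ey, hxm, ← mul_sub] at hder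
  generalize (V.wtTrace fun ν => ν * qpow r ((j + 1 + (l - 1) * r) * ν)) = X at *
  generalize (V.wtTrace fun ν => ν * qpow r ((-(j + 1) + (l + 1) * r) * ν)) = Y at *
  have hder' : (Y - X) * br r 1 = qint r (j + 1) * (-(-1) ^ l + -(-1) ^ l) * g μ₀ := by
    refine mul_left_cancel₀ hpi ?_
    rw [← mul_assoc, hder]
    field_simp
  rw [div_mul_eq_mul_div, eq_div_iff (mul_ne_zero two_ne_zero hj1)]
  linear_combination hder'

end WeightModule

theorem PE_wR (r j n : ℕ) : opOf (PE r j) (wR r j n) = wR r j (n + 1) := by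
  rcases Nat.lt_or_ge n (r - 1 - j) with h | h
  · rw [op_wR _ h]; rfl
  · rw [wR, dif_neg (by omega), wR, dif_neg (by omega), map_zero]

theorem PE_pow_wH (r j n : ℕ) : (opOf (PE r j) ^ (n + 1)) (wH r j 0) = wR r j n := by
  induction n with
  | zero => rw [zero_add, pow_one, op_wH _ (Nat.succ_pos j)]; rfl
  | succ n ih => rw [pow_succ', Module.End.mul_apply, ih, PE_wR]

theorem PF_pow_wR (r j n : ℕ) (hj : j + 2 ≤ r) (hn : n < r - 1 - j) :
    (opOf (PF r j) ^ (n + 1)) (wR r j n)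
      = (∏ k ∈ Finset.range n, -(qint r (1 + j + (k + 1 : ℕ)) * qint r (k + 1 : ℕ))) •
        wS r j 0 := by
  induction n with
  | zero => rw [zero_add, pow_one, op_wR _ hn]; simp [PF]
  | succ n ih =>
    rw [pow_succ, Module.End.mul_apply, PF_wR r j n hj (by omega), map_smul, ih (by omega),
      smul_smul, Finset.prod_range_succ, mul_comm]

theorem C_H (r : ℕ) [NeZero r] (k : ℤ) (v : (C r k).carrier) :
    (C r k).ρ (gen r .H) v = ((k : ℂ) * r) • v := by
  have h : (C r k).ρ (gen r .H) = ((k : ℂ) * r) • (1 : Module.End ℂ (Fin 1 →₀ ℂ)) := by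
    refine (liftU_gen (BasisData.relations _) .H).trans (op_ext fun a => ?_)
    refine (diagOp_single _ _).trans ?_
    obtain rfl : a = 0 := Subsingleton.elim _ _
    simp
  exact LinearMap.congr_fun h v

namespace WeightModule

variable {r : ℕ} [NeZero r]

theorem tensor_H_tmul (V W : WeightModule r) (v : V.carrier) (w : W.carrier) :
    (V.tensor W).ρ (gen r .H) (v ⊗ₜ[ℂ] w : V.carrier ⊗[ℂ] W.carrier)
      = (v ⊗ₜ[ℂ] W.ρ (gen r .H) w + V.ρ (gen r .H) v ⊗ₜ[ℂ] w : V.carrier ⊗[ℂ] W.carrier) :=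
  LinearMap.congr_fun (tensorAction_gen V W .H) _

theorem wt_tmul {V W : WeightModule r} {μ ν : ℂ} {v : V.carrier} {w : W.carrier}
    (hv : V.ρ (gen r .H) v = μ • v) (hw : W.ρ (gen r .H) w = ν • w) :
    (V.tensor W).ρ (gen r .H) (v ⊗ₜ[ℂ] w : V.carrier ⊗[ℂ] W.carrier)
      = ((μ + ν) • (v ⊗ₜ[ℂ] w) : V.carrier ⊗[ℂ] W.carrier) := by
  rw [tensor_H_tmul, hv, hw, TensorProduct.tmul_smul, ← TensorProduct.smul_tmul', add_smul,
    add_comm]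

theorem wt_tmulC (j : ℕ) (hj : j + 2 ≤ r) (l : ℤ) :
    ((P r j hj).tensor (C r l)).ρ (gen r .H) (tmulC r j hj l (wH r j 0))
      = ((j : ℂ) + l * r) • tmulC r j hj l (wH r j 0) := by
  have hH : (P r j hj).ρ (gen r .H) (wH r j 0) = (j : ℂ) • wH r j 0 := by
    rw [P_gen, wH, dif_pos (Nat.succ_pos j)]
    refine (diagOp_single _ _).trans ?_
    simp [Pwt]
  exact wt_tmul (V := P r j hj) (W := C r l) hH (C_H r l (Cvec r l))

theorem tmulC_E_pow (j : ℕ) (hj : j + 2 ≤ r) (l : ℤ) (n : ℕ) (w : PIdx r j →₀ ℂ) :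
    ((P r j hj).tensor (C r l)).ρ (gen r .E ^ n) (tmulC r j hj l w)
      = ((-1 : ℂ) ^ l) ^ n • tmulC r j hj l ((opOf (PE r j) ^ n) w) := by
  induction n with
  | zero => simp
  | succ n ih =>
    rw [pow_succ', map_mul, Module.End.mul_apply, ih, map_smul, tmulC_E, smul_smul,
      qpow_int_r r (NeZero.ne r), pow_succ' (opOf _), Module.End.mul_apply, pow_succ]

theorem tmulC_F_pow (j : ℕ) (hj : j + 2 ≤ r) (l : ℤ) (n : ℕ) (w : PIdx r j →₀ ℂ) :
    ((P r j hj).tensor (C r l)).ρ (gen r .F ^ n) (tmulC r j hj l w)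
      = tmulC r j hj l ((opOf (PF r j) ^ n) w) := by
  induction n with
  | zero => simp
  | succ n ih =>
    rw [pow_succ', map_mul, Module.End.mul_apply, ih, tmulC_F, pow_succ' (opOf _),
      Module.End.mul_apply]

theorem hopf_tmulC_wH (V : WeightModule r) (j : ℕ) (hj : j + 2 ≤ r) (l : ℤ) :
    hopf V ((P r j hj).tensor (C r l)) (tmulC r j hj l (wH r j 0))
      = (V.wtTrace fun ν => qpow r ((j + 1 + (l - 1) * r) * ν)) • tmulC r j hj l (wH r j 0)
        + (br r 1 / (2 * qint r (j + 1)) *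
        ((V.wtTrace fun ν => ν * qpow r ((j + 1 + (l - 1) * r) * ν))
          - V.wtTrace fun ν => ν * qpow r ((-(j + 1) + (l + 1) * r) * ν)))
          • tmulC r j hj l (wS r j 0) := by
  have hterm : ∀ n : ℕ, ((P r j hj).tensor (C r l)).ρ (gen r .F ^ (n + 1))
      (((P r j hj).tensor (C r l)).ρ (gen r .E ^ (n + 1)) (tmulC r j hj l (wH r j 0)))
      = ((-1 : ℂ) ^ l) ^ (n + 1) • tmulC r j hj l ((opOf (PF r j) ^ (n + 1)) (wR r j n)) := by
    intro n
    rw [tmulC_E_pow, map_smul, tmulC_F_pow, PE_pow_wH]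
  have hsub : Finset.range (r - 1 - j + 1) ⊆ Finset.range r :=
    Finset.range_subset_range.2 (by omega)
  rw [hopf_apply (NeZero.ne r) (wt_tmulC j hj l), ← Finset.sum_subset hsub, Finset.sum_range_succ',
    ← sum_hopfCoeff_nilpotent V hj l, Finset.sum_smul, add_comm]
  · congr 1
    · rw [hopfCoeff_zero, qTrace_zero, pow_zero, pow_zero, map_one, Module.End.one_apply,
        Module.End.one_apply, show (j : ℂ) + l * r + 1 - r = j + 1 + (l - 1) * r by ring]
    · refine Finset.sum_congr rfl fun n hn => ?_
      rw [hterm, PF_pow_wR r j n hj (Finset.mem_range.1 hn), map_smul, smul_smul, smul_smul]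
  · intro n hn hn'
    rw [Finset.mem_range] at hn hn'
    obtain ⟨n, rfl⟩ : ∃ k, n = k + 1 := ⟨n - 1, by omega⟩
    rw [hterm, wR, dif_neg (by omega), map_zero, map_zero, smul_zero, smul_zero]

/-- The open Hopf link on `P_j ⊗ ℂ^H_{lr}`, in terms of the weights of its colour. -/
theorem hopf_P_tensor_C (V : WeightModule r) (j : ℕ) (hj : j + 2 ≤ r) (l : ℤ) :
    hopf V ((P r j hj).tensor (C r l))
      = (V.wtTrace fun ν => qpow r ((j + 1 + (l - 1) * r) * ν)) • LinearMap.id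
        + (br r 1 / (2 * qint r (j + 1)) *
        ((V.wtTrace fun ν => ν * qpow r ((j + 1 + (l - 1) * r) * ν))
          - V.wtTrace fun ν => ν * qpow r ((-(j + 1) + (l + 1) * r) * ν)))
          • (xPC r j hj l).toLin := by
  have hw := hopf_tmulC_wH V j hj l
  set a := V.wtTrace fun ν => qpow r ((j + 1 + (l - 1) * r) * ν)
  set b := br r 1 / (2 * qint r (j + 1)) *
        ((V.wtTrace fun ν => ν * qpow r ((j + 1 + (l - 1) * r) * ν))
          - V.wtTrace fun ν => ν * qpow r ((-(j + 1) + (l + 1) * r) * ν))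
  have hc := (hopfHom (NeZero.ne r) V ((P r j hj).tensor (C r l))).comm
  have hx := (xPC r j hj l).comm
  -- Subtracting the claimed value and adding `x` gives a homomorphism that agrees with `x` on the
  -- generator `w^H_j ⊗ v`.
  let f : Hom ((P r j hj).tensor (C r l)) ((P r j hj).tensor (C r l)) :=
    { toLin := hopf V ((P r j hj).tensor (C r l)) - a • LinearMap.id - b • (xPC r j hj l).toLin
        + (xPC r j hj l).toLin
      comm := fun u => LinearMap.ext fun w => by
        have h1 := LinearMap.congr_fun (hc u) w
        have h2 := LinearMap.congr_fun (hx u) w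
        simp only [LinearMap.comp_apply] at h1 h2
        change hopf V _ _ = _ at h1
        simp only [LinearMap.comp_apply, LinearMap.add_apply, LinearMap.sub_apply,
          LinearMap.smul_apply, LinearMap.id_apply, map_add, map_sub, map_smul, h1, h2]
        rfl }
  have hf : f.toLin (tmulC r j hj l (wH r j 0)) = tmulC r j hj l (wS r j 0) := by
    simp only [f, LinearMap.add_apply, LinearMap.sub_apply,
          LinearMap.smul_apply, LinearMap.id_apply, xPC_apply, hw]
    abel
  have h := congrArg Hom.toLin (xPC_unique r j hj l f hf)
  change hopf V ((P r j hj).tensor (C r l)) - a • LinearMap.id - b • (xPC r j hj l).toLin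
        + (xPC r j hj l).toLin = _ at h
  rw [add_eq_right, sub_sub, sub_eq_zero] at h
  exact h

end WeightModule

/-! ### Weights of the colours -/

theorem trace_diagOp {ι : Type} [Fintype ι] (c : ι → ℂ) :
    LinearMap.trace ℂ (ι →₀ ℂ) (diagOp c) = ∑ a, c a := by
  classical
  rw [LinearMap.trace_eq_matrix_trace ℂ Finsupp.basisSingleOne]
  refine Finset.sum_congr rfl fun a _ => ?_
  rw [Matrix.diag_apply, LinearMap.toMatrix_apply, Finsupp.coe_basisSingleOne, diagOp_single]
  simp

theorem BasisData.wtTrace_toWeightModule {r : ℕ} {ι : Type} [Fintype ι] (D : BasisData r ι)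
    (φ : ℂ → ℂ) : D.toWeightModule.wtTrace φ = ∑ a, φ (D.wt a) := by
  have h : D.toWeightModule.wtOp φ = diagOp fun a => φ (D.wt a) := by
    refine op_ext fun a => ?_
    have ha : D.toWeightModule.ρ (gen r .H) (Finsupp.single a 1 : ι →₀ ℂ)
        = (D.wt a • Finsupp.single a 1 : ι →₀ ℂ) :=
      (LinearMap.congr_fun (liftU_gen D.relations .H) _).trans (diagOp_single _ _)
    rw [diagOp_single]
    exact WeightModule.wtOp_apply (V := D.toWeightModule) φ ha
  rw [WeightModule.wtTrace, h]
  exact trace_diagOp _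

theorem wtTrace_stringModule (r n : ℕ) (lam : ℂ) (c : ℕ → ℂ) (hn : n ≤ r) (h0 : c 0 = 0)
    (hcn : c n = 0) (hc : ∀ k : ℕ, k < n → c (k + 1) - c k = qint r (lam - 2 * k)) (φ : ℂ → ℂ) :
    (stringModule r n lam c hn h0 hcn hc).wtTrace φ
      = ∑ m ∈ Finset.range n, φ (lam - 2 * m) :=
  (BasisData.wtTrace_toWeightModule _ φ).trans
    (Fin.sum_univ_eq_sum_range (fun m : ℕ => φ (lam - 2 * m)) n)

theorem wtTrace_S (r i : ℕ) (hi : i < r) (φ : ℂ → ℂ) :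
    (S r i hi).wtTrace φ = ∑ m ∈ Finset.range (i + 1), φ (i - 2 * m) :=
  wtTrace_stringModule ..

theorem wtTrace_V (r : ℕ) [NeZero r] (α : ℂ) (φ : ℂ → ℂ) :
    (V r α).wtTrace φ = ∑ m ∈ Finset.range r, φ (α + r - 1 - 2 * m) :=
  wtTrace_stringModule ..

/-- The weights of `P_i` are those of a string of length `r` with highest weight `i` and their
negatives. -/
theorem wtTrace_P (r i : ℕ) (hi : i + 2 ≤ r) (φ : ℂ → ℂ) :
    (P r i hi).wtTrace φ
      = ∑ m ∈ Finset.range r, (φ (i - 2 * m) + φ (-(i - 2 * m))) := by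
  have hr : r = i + 1 + (r - 1 - i) := by omega
  refine (BasisData.wtTrace_toWeightModule (Pdata r i hi) φ).trans ?_
  change ∑ a, φ (Pwt r i a) = _
  rw [Finset.sum_add_distrib, Fintype.sum_sum_type, Fintype.sum_sum_type, Fintype.sum_sum_type]
  simp only [Pwt]
  rw [Fin.sum_univ_eq_sum_range (fun m : ℕ => φ (i - 2 * m)),
    Fin.sum_univ_eq_sum_range (fun m : ℕ => φ (-i - 2 - 2 * m)),
    Fin.sum_univ_eq_sum_range (fun m : ℕ => φ (i + 2 + 2 * m))]
  congr 1
  · conv_rhs => rw [hr, Finset.sum_range_add]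
    congr 1
    refine Finset.sum_congr rfl fun m _ => ?_
    congr 1; push_cast; ring
  · conv_rhs => rw [hr, Finset.sum_range_add, ← Finset.sum_range_reflect]
    congr 1
    · refine Finset.sum_congr rfl fun m hm => ?_
      rw [show i + 1 - 1 - m = i - m by omega,
        Nat.cast_sub (by have := Finset.mem_range.1 hm; omega)]
      congr 1; ring
    · refine Finset.sum_congr rfl fun m _ => ?_
      congr 1; push_cast; ring

/-- Tensoring with `ℂ^H_{kr}` shifts all weights by `k r`. -/
theorem wtTrace_tensor_C {r : ℕ} [NeZero r] (M : WeightModule r) (k : ℤ) (φ : ℂ → ℂ) :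
    (M.tensor (C r k)).wtTrace φ = M.wtTrace fun ν => φ (ν + k * r) := by
  have h : (M.tensor (C r k)).wtOp φ
      = TensorProduct.map (M.wtOp fun ν => φ (ν + k * r)) (1 : Module.End ℂ (C r k).carrier) := by
    refine TensorProduct.ext (LinearMap.ext fun v => LinearMap.ext fun w => ?_)
    have h2 : ((M.tensor (C r k)).wtOp φ ∘ₗ (TensorProduct.mk ℂ M.carrier (C r k).carrier).flip w :
          M.carrier →ₗ[ℂ] M.carrier ⊗[ℂ] (C r k).carrier)
        = (TensorProduct.mk ℂ M.carrier (C r k).carrier).flip w ∘ₗ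
          M.wtOp fun ν => φ (ν + k * r) := by
      refine M.ext_weight fun μ v hv => ?_
      refine (WeightModule.wtOp_apply φ (WeightModule.wt_tmul hv (C_H r k w))).trans ?_
      rw [LinearMap.comp_apply, WeightModule.wtOp_apply _ hv, map_smul]
      rfl
    exact LinearMap.congr_fun h2 v
  rw [WeightModule.wtTrace, h]
  refine (LinearMap.trace_tensorProduct' _ _).trans ?_
  have h1 : LinearMap.trace ℂ (C r k).carrier 1 = 1 := by
    rw [LinearMap.trace_one]
    change ((Module.finrank ℂ (Fin 1 →₀ ℂ) : ℕ) : ℂ) = 1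
    simp
  rw [h1, mul_one, WeightModule.wtTrace]

/-! ### Sums over strings of weights -/

theorem br_mul_sum_qpow (r n : ℕ) (x c : ℂ) :
    br r x * ∑ m ∈ Finset.range n, qpow r (x * (c - 2 * m))
      = qpow r (x * (c + 1)) - qpow r (x * (c + 1 - 2 * n)) := by
  induction n with
  | zero => simp
  | succ n ih =>
    have e1 : qpow r (x * (c + 1 - 2 * n)) = qpow r (x * (c - 2 * n)) * qpow r x := by
      rw [← qpow_add]; congr 1; ring
    have e2 : qpow r (x * (c + 1 - 2 * (n + 1 : ℕ))) = qpow r (x * (c - 2 * n)) * qpow r (-x) := by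
      rw [← qpow_add]; congr 1; push_cast; ring
    rw [Finset.sum_range_succ, mul_add, ih, e1, e2, br]
    ring

theorem br_sq_mul_sum_mul_qpow (r n : ℕ) (x c : ℂ) :
    br r x ^ 2 * ∑ m ∈ Finset.range n, (c - 2 * m) * qpow r (x * (c - 2 * m))
      = br r x * (c * qpow r (x * (c + 1)) - (c - 2 * n) * qpow r (x * (c - 2 * n + 1)))
        - 2 * (qpow r (x * c) - qpow r (x * (c - 2 * n))) := by
  induction n with
  | zero => simp
  | succ n ih =>
    have e1 : qpow r (x * (c - 2 * n + 1)) = qpow r (x * (c - 2 * n)) * qpow r x := by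
      rw [← qpow_add]; congr 1; ring
    have e2 : qpow r (x * (c - 2 * (n + 1 : ℕ)))
        = qpow r (x * (c - 2 * n)) * (qpow r (-x) * qpow r (-x)) := by
      rw [← qpow_add, ← qpow_add]; congr 1; push_cast; ring
    have e3 : qpow r (x * (c - 2 * (n + 1 : ℕ) + 1)) = qpow r (x * (c - 2 * n)) * qpow r (-x) := by
      rw [← qpow_add]; congr 1; push_cast; ring
    have h := qpow_mul_neg r x
    rw [Finset.sum_range_succ, mul_add, ih, e1, e2, e3, br]
    push_cast
    generalize qpow r (x * (c - 2 * n)) = A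
    generalize qpow r x = X at *
    generalize qpow r (-x) = X' at *
    linear_combination (-2 * A) * h

/-- The sum of `q ^ (x ν)` over the weights `ν` of `S_i`. -/
theorem br_mul_sum_qpow_string (r i : ℕ) (x : ℂ) :
    br r x * ∑ m ∈ Finset.range (i + 1), qpow r (x * (i - 2 * m)) = br r ((i + 1) * x) := by
  rw [br_mul_sum_qpow, br]
  congr 2
  · ring
  · push_cast; ring

theorem br_sq_mul_sum_mul_br_string (r i : ℕ) (x : ℂ) :
    br r x ^ 2 * ∑ m ∈ Finset.range (i + 1), (i - 2 * m) * br r (x * (i - 2 * m))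
      = 2 * (i * br r ((i + 2) * x) - (i + 2) * br r (i * x)) := by
  have h1 := br_sq_mul_sum_mul_qpow r (i + 1) x i
  have h2 := br_sq_mul_sum_mul_qpow r (i + 1) (-x) i
  have hs : ∑ m ∈ Finset.range (i + 1), ((i : ℂ) - 2 * m) * br r (x * (i - 2 * m))
      = ∑ m ∈ Finset.range (i + 1), ((i : ℂ) - 2 * m) * qpow r (x * (i - 2 * m))
        - ∑ m ∈ Finset.range (i + 1), ((i : ℂ) - 2 * m) * qpow r (-x * (i - 2 * m)) := by
    rw [← Finset.sum_sub_distrib]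
    refine Finset.sum_congr rfl fun m _ => ?_
    rw [br, neg_mul, mul_sub]
  rw [br_neg, neg_sq] at h2
  rw [hs, mul_sub, h1, h2]
  have e1 : x * ((i : ℂ) - 2 * (i + 1 : ℕ) + 1) = -(x * (i + 1)) := by push_cast; ring
  have e2 : -x * ((i : ℂ) - 2 * (i + 1 : ℕ) + 1) = x * (i + 1) := by push_cast; ring
  have e3 : x * ((i : ℂ) - 2 * (i + 1 : ℕ)) = -(x * (i + 1) + x) := by push_cast; ring
  have e4 : -x * ((i : ℂ) - 2 * (i + 1 : ℕ)) = x * (i + 1) + x := by push_cast; ring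
  have e5 : x * (i : ℂ) = x * (i + 1) + -x := by ring
  have e6 : -x * (i : ℂ) = -(x * (i + 1)) + x := by ring
  have e7 : ((i : ℂ) + 2) * x = x * (i + 1) + x := by ring
  have e8 : (i : ℂ) * x = x * (i + 1) + -x := by ring
  rw [e1, e2, e3, e4, e5, e6, e7, e8, neg_mul x]
  simp only [br, neg_add, neg_neg, qpow_add]
  push_cast
  ring

theorem qpow_int_mul_sub (r : ℕ) (hr : r ≠ 0) (x : ℤ) (c : ℂ) :
    qpow r (x * (c - 2 * r)) = qpow r (x * c) := by
  have h : (x : ℂ) * (c - 2 * r) = x * c + ((-2 * x : ℤ) : ℂ) * r := by push_cast; ring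
  rw [h, qpow_add, qpow_int_r r hr, zpow_mul]
  simp

/-- If `x` is an integer with `{x} ≠ 0`, then over a full string of `r` weights the sum of
`q ^ (x ν)` vanishes. -/
theorem sum_qpow_full (r : ℕ) (hr : r ≠ 0) (x : ℤ) (hx : br r x ≠ 0) (c : ℂ) :
    ∑ m ∈ Finset.range r, qpow r (x * (c - 2 * m)) = 0 := by
  have h := br_mul_sum_qpow r r x c
  rw [qpow_int_mul_sub r hr, sub_self] at h
  exact (mul_eq_zero.1 h).resolve_left hx

theorem sum_mul_qpow_full (r : ℕ) (hr : r ≠ 0) (x : ℤ) (hx : br r x ≠ 0) (c : ℂ) :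
    ∑ m ∈ Finset.range r, (c - 2 * m) * qpow r (x * (c - 2 * m))
      = 2 * r * qpow r (x * (c + 1)) / br r x := by
  have h := br_sq_mul_sum_mul_qpow r r x c
  rw [show (c : ℂ) - 2 * r + 1 = c + 1 - 2 * r by ring, qpow_int_mul_sub r hr,
    qpow_int_mul_sub r hr, sub_self, mul_zero, sub_zero] at h
  rw [eq_div_iff hx]
  refine mul_left_cancel₀ hx ?_
  linear_combination h

/-- The sign by which the two characters in the open Hopf link on `P_j ⊗ ℂ^H_{lr}` change on
integral weights of fixed parity. -/
theorem qpow_shift (r : ℕ) (hr : r ≠ 0) (i j : ℕ) (k l d : ℤ) {N : ℂ} (hN : N = i - 2 * d) :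
    qpow r ((j + 1 + (l - 1) * r) * (N + k * r))
        = (-1 : ℂ) ^ ((i : ℤ) + l * i + k * (j + 1 - r + l * r)) * qpow r ((j + 1) * N) ∧
      qpow r ((-(j + 1) + (l + 1) * r) * (N + k * r))
        = (-1 : ℂ) ^ ((i : ℤ) + l * i + k * (j + 1 - r + l * r)) * qpow r (-((j + 1) * N)) := by
  have hsq : ∀ a b : ℤ, (-1 : ℂ) ^ (a + 2 * b) = (-1) ^ a := fun a b => by
    rw [zpow_add₀ (by norm_num), zpow_mul]; simp
  constructor
  · rw [← hsq _ (-i - (l - 1) * d), ← qpow_int_r r hr, ← qpow_add, hN]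
    congr 1; push_cast; ring
  · rw [← hsq _ (-(l + 1) * d + k * (r - (j + 1))), ← qpow_int_r r hr, ← qpow_add, hN]
    congr 1; push_cast; ring

end

end UnrolledSl2

open UnrolledSl2 in
theorem mainTheorem6 (r : ℕ) [NeZero r] (hr : 2 ≤ r) (j : ℕ) (hj : j + 2 ≤ r) (l : ℤ) :
    -- atypical simple colours `S_i ⊗ ℂ^H_{kr}`
    (∀ (i : ℕ) (hi : i + 2 ≤ r) (k : ℤ),
      WeightModule.hopf ((S r i (by omega)).tensor (C r k)) ((P r j hj).tensor (C r l)) =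
        ((-1 : ℂ) ^ ((i : ℤ) + l * i + k * (j + 1 - r + l * r)) *
            (br r ((i + 1) * (j + 1)) / br r (j + 1))) • LinearMap.id +
          ((-1 : ℂ) ^ ((i : ℤ) + l * i + k * (j + 1 - r + l * r)) *
            ((i * br r ((i + 2) * (j + 1)) - (i + 2) * br r (i * (j + 1))) /
              (qint r (j + 1) ^ 2 * br r (j + 1)))) • (xPC r j hj l).toLin) ∧
    -- the colours `V_α`
    (∀ α : ℂ,
      WeightModule.hopf (V r α) ((P r j hj).tensor (C r l)) =
        (0 : ℂ) • LinearMap.id +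
          ((-1 : ℂ) ^ (l * ((r : ℤ) - 1)) * qpow r (α * l * r) *
            ((-1 : ℂ) ^ ((r : ℤ) - j) * r / qint r (j + 1) ^ 2) *
            (qpow r ((r - 1 - j) * α) + qpow r (-((r - 1 - j) * α)))) • (xPC r j hj l).toLin) ∧
    -- projective colours `P_i ⊗ ℂ^H_{kr}`
    (∀ (i : ℕ) (hi : i + 2 ≤ r) (k : ℤ),
      WeightModule.hopf ((P r i hi).tensor (C r k)) ((P r j hj).tensor (C r l)) =
        (0 : ℂ) • LinearMap.id +
          (2 * r * (-1 : ℂ) ^ ((i : ℤ) + l * i + k * (j + 1 - r + l * r)) / qint r (j + 1) ^ 2 *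
            (qpow r ((i + 1) * (j + 1)) + qpow r (-((i + 1) * (j + 1))))) •
              (xPC r j hj l).toLin) := by
  have hr0 : r ≠ 0 := NeZero.ne r
  have h1 : br r 1 ≠ 0 := br_one_ne_zero hr
  have hx : br r ((j : ℂ) + 1) ≠ 0 := by
    exact_mod_cast br_ne_zero (r := r) (Nat.succ_pos j) (by omega)
  have hsplit : ∀ (k : ℤ) (N s : ℂ),
      (N + k * r) * (s * qpow r ((j + 1) * N)) - (N + k * r) * (s * qpow r (-((j + 1) * N)))
        = s * (N * br r ((j + 1) * N) + k * r * br r ((j + 1) * N)) := fun k N s => by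
    rw [br]; ring
  refine ⟨fun i hi k => ?_, fun α => ?_, fun i hi k => ?_⟩
  · rw [WeightModule.hopf_P_tensor_C]
    simp only [wtTrace_tensor_C, wtTrace_S]
    have hs := fun m : ℕ => qpow_shift r hr0 i j k l m (N := i - 2 * m) (by simp)
    simp only [hs]
    generalize (-1 : ℂ) ^ ((i : ℤ) + l * i + k * (j + 1 - r + l * r)) = s
    have ha := br_mul_sum_qpow_string r i (j + 1)
    have ha' := br_mul_sum_qpow_string r i (-(j + 1))
    have hb := br_sq_mul_sum_mul_br_string r i (j + 1)
    -- The weights of `S_i` are symmetric, so the contribution of `k r` to the weights cancels.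
    have hodd : ∑ m ∈ Finset.range (i + 1), br r ((j + 1) * ((i : ℂ) - 2 * m)) = 0 := by
      refine (mul_eq_zero.1 ?_).resolve_left hx
      simp only [br.eq_1 r (((j : ℂ) + 1) * (_ - _)), Finset.sum_sub_distrib]
      rw [br_neg, mul_neg, br_neg] at ha'
      simp only [neg_mul] at ha' ⊢
      linear_combination ha + ha'
    rw [← Finset.sum_sub_distrib]
    simp only [hsplit, ← Finset.mul_sum, Finset.sum_add_distrib, hodd]
    congr 2
    · rw [← ha]; field_simp
    · rw [qint]
      generalize br r (((i : ℂ) + 2) * (j + 1)) = A at *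
      generalize br r ((i : ℂ) * (j + 1)) = B at *
      field_simp
      linear_combination s * hb
  · rw [WeightModule.hopf_P_tensor_C]
    simp only [wtTrace_V]
    -- Both exponents are integers, so the sums over the `r` weights of `V_α` are full strings.
    have hy : br r (((j + 1 + (l - 1) * r : ℤ)) : ℂ) = -(-1) ^ l * br r (j + 1) := by
      have h := br_add_int_mul_r r (j + 1) (l - 1)
      rw [zpow_sub₀ (by norm_num)] at h
      push_cast at h ⊢
      rw [h]; norm_num [div_neg]
    have hy' : br r (((-(j + 1) + (l + 1) * r : ℤ)) : ℂ) = (-1) ^ l * br r (j + 1) := by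
      have h := br_add_int_mul_r r (-(j + 1)) (l + 1)
      rw [zpow_add₀ (by norm_num), br_neg] at h
      push_cast at h ⊢
      rw [h]; norm_num
    have hl : ((-1 : ℂ) ^ l) * (-1) ^ l = 1 := by rw [← mul_zpow]; norm_num
    have hl0 : (-1 : ℂ) ^ l ≠ 0 := left_ne_zero_of_mul_eq_one hl
    have hy0 : br r (((j + 1 + (l - 1) * r : ℤ)) : ℂ) ≠ 0 := by
      rw [hy]; exact mul_ne_zero (neg_ne_zero.2 hl0) hx
    have hy0' : br r (((-(j + 1) + (l + 1) * r : ℤ)) : ℂ) ≠ 0 := by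
      rw [hy']; exact mul_ne_zero hl0 hx
    have ha := sum_qpow_full r hr0 _ hy0 (α + r - 1)
    have hb := sum_mul_qpow_full r hr0 _ hy0 (α + r - 1)
    have hb' := sum_mul_qpow_full r hr0 _ hy0' (α + r - 1)
    rw [hy] at hb
    rw [hy'] at hb'
    have hsq : ∀ a b : ℤ, (-1 : ℂ) ^ (a + 2 * b) = (-1) ^ a := fun a b => by
      rw [zpow_add₀ (by norm_num), zpow_mul]; simp
    have hsign : -((-1 : ℂ) ^ l * (-1) ^ (l * ((r : ℤ) - 1)) * (-1) ^ ((r : ℤ) - j))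
        = (-1) ^ (l * r + r - j + 1) := by
      rw [← zpow_add₀ (by norm_num), ← zpow_add₀ (by norm_num), zpow_add_one₀ (by norm_num),
        mul_neg_one]
      congr 2; ring
    have e1 : qpow r (((j + 1 + (l - 1) * r : ℤ) : ℂ) * (α + r - 1 + 1))
        = -((-1) ^ l * (-1) ^ (l * ((r : ℤ) - 1)) * (-1) ^ ((r : ℤ) - j)) *
          (qpow r (α * l * r) * qpow r (-((r - 1 - j) * α))) := by
      rw [hsign, ← hsq _ (j - r), ← qpow_int_r r hr0, ← qpow_add, ← qpow_add]
      congr 1; push_cast; ring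
    have e2 : qpow r (((-(j + 1) + (l + 1) * r : ℤ) : ℂ) * (α + r - 1 + 1))
        = -((-1) ^ l * (-1) ^ (l * ((r : ℤ) - 1)) * (-1) ^ ((r : ℤ) - j)) *
          (qpow r (α * l * r) * qpow r ((r - 1 - j) * α)) := by
      rw [hsign, ← hsq _ (-1), ← qpow_int_r r hr0, ← qpow_add, ← qpow_add]
      congr 1; push_cast; ring
    rw [e1] at hb
    rw [e2] at hb'
    push_cast at ha hb hb'
    rw [ha, hb, hb', qint]
    congr 2
    field_simp
    ring
  · rw [WeightModule.hopf_P_tensor_C]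
    simp only [wtTrace_tensor_C, wtTrace_P]
    have hs := fun m : ℕ => qpow_shift r hr0 i j k l m (N := i - 2 * m) (by simp)
    have hs' := fun m : ℕ => qpow_shift r hr0 i j k l (i - m) (N := -(i - 2 * m))
      (by push_cast; ring)
    simp only [hs, hs']
    generalize (-1 : ℂ) ^ ((i : ℤ) + l * i + k * (j + 1 - r + l * r)) = s
    have hxZ : br r ((j + 1 : ℤ) : ℂ) ≠ 0 := by push_cast; exact hx
    have hxZ' : br r ((-(j + 1) : ℤ) : ℂ) ≠ 0 := by
      push_cast; rw [br_neg]; exact neg_ne_zero.2 hx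
    have ha := sum_qpow_full r hr0 _ hxZ i
    have ha' := sum_qpow_full r hr0 _ hxZ' i
    have hb := sum_mul_qpow_full r hr0 _ hxZ i
    have hb' := sum_mul_qpow_full r hr0 _ hxZ' i
    push_cast at ha ha' hb hb'
    rw [br_neg] at hb'
    rw [← Finset.sum_sub_distrib]
    have hterm : ∀ m : ℕ,
        ((i - 2 * m + k * r) * (s * qpow r ((j + 1) * (i - 2 * m)))
          + (-(i - 2 * m) + k * r) * (s * qpow r ((j + 1) * -(i - 2 * m)))
        - ((i - 2 * m + k * r) * (s * qpow r (-((j + 1) * (i - 2 * m))))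
          + (-(i - 2 * m) + k * r) * (s * qpow r (-((j + 1) * -(i - 2 * m))))) : ℂ)
        = 2 * s * ((i - 2 * m) * qpow r ((j + 1) * (i - 2 * m))
          - (i - 2 * m) * qpow r (-(j + 1) * (i - 2 * m))) := by
      intro m
      rw [mul_neg, neg_neg, neg_mul ((j : ℂ) + 1)]
      ring
    simp only [hterm, ← Finset.mul_sum, Finset.sum_sub_distrib, Finset.sum_add_distrib]
    rw [hb, hb', ha]
    simp only [mul_neg, ← neg_mul ((j : ℂ) + 1), ha', mul_zero, add_zero, qint]
    congr 2
    rw [neg_mul, mul_comm ((j : ℂ) + 1)]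
    field_simp
    ring
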